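/- **Setting.** Let $\Omega\subset\mathbb R^3$ be a domain, $S\subset\Omega$ a bounded domain, $F=\Omega\setminus\overline S$, $H=\operatorname{diam}S$, and let $h=\operatorname{dist}(S,\partial\Omega)$ be realized by $P\in\partial S$ and $Q\in\partial\Omega$. Use an orthogonal (right-handed) coordinate system $x=(x',x_3)$, $x'=(x_1,x_2)$, with origin $Q$ and $P=(0,0,h)$, such that $\{x_3=0\}$ is the tangent plane of $\partial\Omega$ at $Q$ and the $x_3$-axis points into $\Omega$ at $Q$. $W^{1,2}_0(S,\Omega)$ is the set of $u\in W^{1,2}_0(\Omega;\mathbb R^3)$ for which there are $u_*,\omega\in\mathbb R^3$ with $u(x)=u_*+\omega\times(x-x_*)$ for (almost all) $x\in S$, where $x_*\in\overline S$ is a fixed point. Put $u_P=u_*+\omega\times(P-x_*)$, with components $u_{P\tau}=(u_{P1},u_{P2})$ and $u_{P3}$, and $\omega_\tau=(\omega_1,\omega_2)$. A domain $D$ is uniformly $C^3$ with constants $k,K,\sigma_0>0$ if for every $x_0\in\partial D$ there are an isometry $\mathcal R$ of $\mathbb R^3$ with $\mathcal R(0)=x_0$ and a function $g$ of class $C^3$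 on $\{|x'|<\sigma_0\}$ such that, for $|x'|<\sigma_0$, $|g(x')|\le k|x'|^2$, $|\nabla^ig(x')|\le K|x'|^{2-i}$ for $i=0,1,2$, $|\nabla^3g(x')|\le K$, and, for $|x'|<\sigma_0$, $|x_3|<k\sigma_0^2$, one has $\mathcal R(x)\in D$ if and only if $x_3>g(x')$. For $\sigma>0$ let $\mathcal C_\sigma=\{|x'|<\sigma,\ -k\sigma^2<x_3<h+2k\sigma^2\}$. **Proposition 3.1.** For every $K\ge1$ there is a constant $C(K)>0$, depending only on $K$, with the following property. Let $\Omega$ and $S$ be uniformly $C^3$ with constants $k,K,\sigma_0$, where $0<k\le K$ and $\sigma_0>0$, and let $h\in[0,H]$. Let $u\in W^{1,2}_0(S,\Omega)$ satisfy $\operatorname{div}u=0$ in $\Omega$ and $u\in W^{2,2}(F)$. Then for every $\sigma\in(0,\sigma_0/2]$ $$|u_{P3}|\le 3\pi^{-1/2}\sigma^{-2}(h+2K\sigma^2)^{5/2}\,\|\nabla^2u\|_{L^2(\mathcal C_\sigma\cap F)}+C(K)\,\sigma^2|u_{P\tau}|+C(K)\,\sigma\,(h+2K\sigma^2)\,|\omega_\tau|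 .$$ -/

import Mathlib

open MeasureTheory Filter Topology Set
open scoped ENNReal ContDiff

namespace RigidFluid

/-- Euclidean three-space, with coordinates `x 0, x 1, x 2` for $(x_1,x_2,x_3)$. -/
abbrev E3 : Type := EuclideanSpace ℝ (Fin 3)

/-- The Euclidean plane of the horizontal variables $x'=(x_1,x_2)$. -/
abbrev E2 : Type := EuclideanSpace ℝ (Fin 2)

/-- The horizontal (tangential) part $x'=(x_1,x_2)$ of $x=(x_1,x_2,x_3)$. -/
def horiz (x : E3) : E2 := !₂[x 0, x 1]

/-- The standard basis vector in direction `i`. -/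
noncomputable def basisVec (i : Fin 3) : E3 := EuclideanSpace.single i 1

/-- The cross product on Euclidean three-space. -/
def cross (a b : E3) : E3 := WithLp.toLp 2 (crossProduct a.ofLp b.ofLp)

/-- The velocity at `x` of the rigid motion with translational velocity `v` (at the point `c`) and
angular velocity `w`, that is $v + w × (x - c)$. -/
def rigidVelocity (v w c x : E3) : E3 := v + cross w (x - c)

/-- The distance $\inf\{|x-y| : x ∈ A, y ∈ B\}$ of two (non-empty) sets. -/
noncomputable def setDist (A B : Set E3) : ℝ := sInf (Set.image2 dist A B)

/-! ### Domains of class uniformly `C³` -/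

/-- In the orthonormal coordinates of the affine isometry `R` (with origin `R 0`), the set `D` is,
inside the cylinder $|x'| < σ₀$, $|x_3| < kσ₀^2$, the set of points lying strictly above the graph
of the `C³` function `g`. The graph lies between the paraboloids $x_3 = ± k|x'|^2$ (so no boundary
point of `D` satisfies $k|x'|^2 < |x_3| < kσ₀^2$, $|x'| < σ₀$) and
$|∇^i g(x')| ≤ K |x'|^{2-i}$ for `i = 0, 1, 2`, $|∇^3 g(x')| ≤ K$ for $|x'| < σ₀$. -/
structure IsC3Graph (k K σ₀ : ℝ) (D : Set E3) (R : E3 ≃ᵃⁱ[ℝ] E3) (g : E2 → ℝ) : Prop where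
  contDiffOn : ContDiffOn ℝ 3 g (Metric.ball 0 σ₀)
  abs_le : ∀ y : E2, ‖y‖ < σ₀ → |g y| ≤ k * ‖y‖ ^ 2
  norm_le : ∀ i : ℕ, i ≤ 2 → ∀ y : E2, ‖y‖ < σ₀ → ‖iteratedFDeriv ℝ i g y‖ ≤ K * ‖y‖ ^ (2 - i)
  norm_three_le : ∀ y : E2, ‖y‖ < σ₀ → ‖iteratedFDeriv ℝ 3 g y‖ ≤ K
  mem_iff : ∀ x : E3, ‖horiz x‖ < σ₀ → |x 2| < k * σ₀ ^ 2 → (R x ∈ D ↔ g (horiz x) < x 2)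

/-- `D` is uniformly `C³` with constants `k`, `K`, `σ₀`: every boundary point is the origin of
orthonormal coordinates in which `D` is locally the region above a `C³` graph, with the uniform
bounds of `IsC3Graph`. -/
def UniformlyC3 (k K σ₀ : ℝ) (D : Set E3) : Prop :=
  ∀ x₀ ∈ frontier D, ∃ (R : E3 ≃ᵃⁱ[ℝ] E3) (g : E2 → ℝ), R 0 = x₀ ∧ IsC3Graph k K σ₀ D R g

/-- `n` points in the direction of the inner normal of `D` at `x`: the plane through `x` orthogonal
to `n` is tangent to the boundary, and `D` lies locally on the side of `n`. -/
def IsInnerNormal (D : Set E3) (x n : E3) : Prop :=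
  ∀ v : E3, 0 < inner ℝ n v → ∀ᶠ t in 𝓝[>] (0 : ℝ), x + t • v ∈ D ∧ x - t • v ∉ D

/-! ### Sobolev spaces -/

/-- `φ` is a smooth function with compact support in `U`. -/
def IsTest {V : Type*} [NormedAddCommGroup V] [NormedSpace ℝ V] (U : Set E3) (φ : E3 → V) : Prop :=
  ContDiff ℝ ∞ φ ∧ HasCompactSupport φ ∧ tsupport φ ⊆ U

/-- `f'` is the weak partial derivative $∂_i f$ on the open set `U`. -/
def IsWeakPartial (U : Set E3) (i : Fin 3) (f f' : E3 → ℝ) : Prop :=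
  LocallyIntegrableOn f U volume ∧ LocallyIntegrableOn f' U volume ∧
    ∀ φ : E3 → ℝ, IsTest U φ →
      ∫ x in U, f x * fderiv ℝ φ x (basisVec i) = - ∫ x in U, f' x * φ x

/-- `u ∈ L²(U)` and `Du` is its weak gradient on `U`, again in `L²(U)`: `Du x i j` is $∂_i u_j(x)$.
So $u ∈ W^{1,2}(U)$ if and only if such a `Du` exists. -/
def HasW12Gradient (U : Set E3) (u : E3 → E3) (Du : E3 → Fin 3 → Fin 3 → ℝ) : Prop :=
  MemLp u 2 (volume.restrict U) ∧
    ∀ i j, IsWeakPartial U i (fun x => u x j) (fun x => Du x i j) ∧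
      MemLp (fun x => Du x i j) 2 (volume.restrict U)

/-- $u ∈ W^{1,2}_0(U)$: `u` belongs to $W^{1,2}(U)$ and is a limit in the $W^{1,2}(U)$-norm of smooth
vector fields with compact support in `U`. -/
def MemW120 (U : Set E3) (u : E3 → E3) : Prop :=
  ∃ Du : E3 → Fin 3 → Fin 3 → ℝ, HasW12Gradient U u Du ∧
    ∃ φ : ℕ → E3 → E3, (∀ n, IsTest U (φ n)) ∧
      Tendsto (fun n => eLpNorm (fun x => u x - φ n x) 2 (volume.restrict U)) atTop (𝓝 0) ∧
      ∀ i j, Tendsto (fun n => eLpNorm (fun x => Du x i j - fderiv ℝ (φ n) x (basisVec i) j) 2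
        (volume.restrict U)) atTop (𝓝 0)

/-- $u ∈ W^{1,2}_0(S,Ω)$, where `v`, `w` are the translational (at the point `c`) and angular
velocity of the rigid motion with which `u` coincides on `S`. -/
def MemW120Rigid (S Ω : Set E3) (u : E3 → E3) (v w c : E3) : Prop :=
  MemW120 Ω u ∧ ∀ᵐ x ∂(volume.restrict S), u x = rigidVelocity v w c x

/-- $\operatorname{div} u = 0$ in `U`, in the weak sense. -/
def IsDivFree (U : Set E3) (u : E3 → E3) : Prop :=
  ∀ φ : E3 → ℝ, IsTest U φ → ∫ x in U, ∑ i, u x i * fderiv ℝ φ x (basisVec i) = 0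

/-- $u ∈ W^{2,2}(U)$ with weak second derivatives `D2u`: `D2u x i j l` is
$∂_i ∂_j u_l(x)$. -/
def HasW22Hessian (U : Set E3) (u : E3 → E3) (D2u : E3 → Fin 3 → Fin 3 → Fin 3 → ℝ) : Prop :=
  ∃ Du : E3 → Fin 3 → Fin 3 → ℝ, HasW12Gradient U u Du ∧
    ∀ i j l, IsWeakPartial U i (fun x => Du x j l) (fun x => D2u x i j l) ∧
      MemLp (fun x => D2u x i j l) 2 (volume.restrict U)

/-- The norm $‖∇^2 u‖_{L^2(A)}$, with
$|∇^2 u|^2 = \sum_{i,j,l} |∂_i ∂_j u_l|^2$. -/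
noncomputable def hessianL2 (A : Set E3) (D2u : E3 → Fin 3 → Fin 3 → Fin 3 → ℝ) : ℝ :=
  Real.sqrt (∫ x in A, ∑ i, ∑ j, ∑ l, (D2u x i j l) ^ 2)

/-! ### The geometry near the closest points -/

/-- The fluid region $F = Ω ∖ \overline S$. -/
def fluid (S Ω : Set E3) : Set E3 := Ω \ closure S

/-- The cylinder $C_σ = \{|x'| < σ, -kσ^2 < x_3 < h + 2kσ^2\}$. -/
def cyl (k h σ : ℝ) : Set E3 :=
  {x | ‖horiz x‖ < σ ∧ -(k * σ ^ 2) < x 2 ∧ x 2 < h + 2 * k * σ ^ 2}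

end RigidFluid

open RigidFluid

open scoped Convolution

namespace RigidFluid

/-! ### Weak derivatives -/

/-! The bound is a flux balance in the thin gap between body and container. Choose a radial profile
supported in the disc of radius σ and multiply it by a vertical cutoff that equals one across the
gap. Test div u = 0 with the product. Inside the gap the test gradient is purely horizontal. Below
the gap there is no fluid, and above it u is rigid and can be integrated explicitly. Thus the normal
velocity u_P3 times the integral of the profile equals the horizontal flux through the gap, up to
terms in the tangential and angular velocities (`IsGap.integral_horizontal_flux`).

The horizontal flux is then compared with its trapezoidal value. On a vertical segment, u vanishes
at the bottom and is the rigid velocity at the top. The mean of u is therefore half the top value,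
with an error governed by the second vertical derivative times (x₃ - bottom)(top - x₃)
(`IsGap.integral_eq_second_derivative`). By Cauchy-Schwarz this error gives the Hessian term, with
D² from the quadratic weight and a further D^(1/2) from the volume of the gap, where D = h + 2Kσ².

What remains are moments of the graph functions a (bottom) and b (top) against the gradient of the
profile, which is odd. In the translational term the constant h drops out and only the odd parts of
a and b survive. These are O(σ³) by the C³ bounds and the vanishing gradient at the origin
(`IsC3Graph.abs_sub_neg_le`), which yields σ²|u_Pτ|. In the rotational term the b² contributions
cancel and b(h - a) is left, which is bounded by Kσ²D.

Two points need care. First, u is only a Sobolev function and the graphs may touch when h = 0. No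
traces are used: the no-slip condition enters through the weak gradient of the extension by zero,
and the second integration by parts uses weights vanishing on both graphs. Second, both boundaries
must be graphs over the same plane. At closest points the normals agree
(`IsC3Graph.map_basisVec_of_closest`), and `exists_isGap` derives the local picture from this. -/

theorem tendsto_setIntegral_mul_of_bounded {U K : Set E3} {f : E3 → ℝ}
    (hf : AEStronglyMeasurable f (volume.restrict U)) (hK : IntegrableOn f K volume)
    (hKm : MeasurableSet K) {F : ℕ → E3 → ℝ}
    {G : E3 → ℝ} {C : ℝ} (hFm : ∀ n, AEStronglyMeasurable (F n) (volume.restrict U))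
    (hFC : ∀ n x, |F n x| ≤ C)
    (hF0 : ∀ n x, x ∉ K → F n x = 0) (hFG : ∀ x, Tendsto (fun n => F n x) atTop (𝓝 (G x))) :
    Tendsto (fun n => ∫ x in U, f x * F n x) atTop (𝓝 (∫ x in U, f x * G x)) := by
  refine tendsto_integral_of_dominated_convergence (K.indicator fun x => ‖f x‖ * C) ?_ ?_ ?_ ?_
  · exact fun n => hf.mul (hFm n)
  · exact (IntegrableOn.integrable_indicator (hK.norm.mul_const C) hKm).restrict
  · refine fun n => Eventually.of_forall fun x => ?_
    by_cases hx : x ∈ K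
    · rw [indicator_of_mem hx, norm_mul]
      exact mul_le_mul_of_nonneg_left (hFC n x) (norm_nonneg _)
    · rw [indicator_of_notMem hx, hF0 n x hx]; simp
  · exact Eventually.of_forall fun x => (hFG x).const_mul _

theorem norm_basisVec (i : Fin 3) : ‖basisVec i‖ = 1 := by simp [basisVec]

/-- The weak derivative may be tested with `C¹` functions of compact support. -/
theorem IsWeakPartial.integral_mul_fderiv {U : Set E3} (hU : IsOpen U) {i : Fin 3}
    {f f' : E3 → ℝ} (h : IsWeakPartial U i f f') {φ : E3 → ℝ} (hφ : ContDiff ℝ 1 φ)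
    (hc : HasCompactSupport φ) (hs : tsupport φ ⊆ U) :
    ∫ x in U, f x * fderiv ℝ φ x (basisVec i) = - ∫ x in U, f' x * φ x := by
  -- Mollification at widths at most δ keeps all supports in one compact subset of U, which serves
  -- as the dominating set.
  obtain ⟨δ, hδ, hδU⟩ := IsCompact.exists_cthickening_subset_open hc hU hs
  set K := Metric.cthickening δ (tsupport φ) with hK
  have hKc : IsCompact K := IsCompact.cthickening hc
  let ρ : ℕ → ContDiffBump (0 : E3) := fun n =>
    ⟨δ / (2 * (n + 1)), δ / (n + 1), by positivity, by
      apply div_lt_div_of_pos_left hδ (by positivity)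
      nlinarith [(Nat.cast_nonneg n : (0 : ℝ) ≤ n)]⟩
  have hρ0 : Tendsto (fun n => (ρ n).rOut) atTop (𝓝 0) := by
    simpa [ρ, div_eq_mul_inv] using (tendsto_one_div_add_atTop_nhds_zero_nat (𝕜 := ℝ)).const_mul δ
  have hρδ : ∀ n, (ρ n).rOut ≤ δ := fun n => by
    simp only [ρ]
    exact div_le_self hδ.le (by simp)
  have conv_bound : ∀ (g : E3 → ℝ), Continuous g → tsupport g ⊆ tsupport φ →
      ∃ C, ∀ n x, |((ρ n).normed volume ⋆[ContinuousLinearMap.lsmul ℝ ℝ, volume] g) x| ≤ C := by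
    intro g hg hgs
    obtain ⟨C, hC⟩ := HasCompactSupport.exists_bound_of_continuous
      (IsCompact.of_isClosed_subset hc (isClosed_tsupport _) hgs) hg
    -- If |g| ≤ C, the mollified value differs from g x by at most 2C, hence is at most 3C uniformly
    -- in n.
    refine ⟨3 * C, fun n x => ?_⟩
    have h1 : dist (((ρ n).normed volume ⋆[ContinuousLinearMap.lsmul ℝ ℝ, volume] g) x) (g x)
        ≤ 2 * C := by
      apply ContDiffBump.dist_normed_convolution_le hg.aestronglyMeasurable
      intro z _
      rw [dist_eq_norm]
      linarith [norm_sub_le (g z) (g x), hC z, hC x]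
    rw [Real.dist_eq] at h1
    have h2 := hC x
    rw [Real.norm_eq_abs] at h2
    have := abs_sub_abs_le_abs_sub
      (((ρ n).normed volume ⋆[ContinuousLinearMap.lsmul ℝ ℝ, volume] g) x) (g x)
    linarith
  have conv_zero : ∀ (g : E3 → ℝ), tsupport g ⊆ tsupport φ → ∀ n x, x ∉ K →
      ((ρ n).normed volume ⋆[ContinuousLinearMap.lsmul ℝ ℝ, volume] g) x = 0 := by
    intro g hgs n x hx
    by_contra hne
    apply hx
    have hx' := support_convolution_subset _ (Function.mem_support.2 hne)
    obtain ⟨a, ha, b, hb, rfl⟩ := Set.mem_add.1 hx'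
    rw [ContDiffBump.support_normed_eq] at ha
    have hb' : b ∈ tsupport φ := hgs (subset_tsupport _ hb)
    refine Metric.mem_cthickening_of_dist_le _ b δ _ hb' ?_
    rw [dist_eq_norm, add_sub_cancel_right]
    rw [Metric.mem_ball, dist_zero_right] at ha
    linarith [hρδ n]
  let Φ : ℕ → E3 → ℝ := fun n =>
    (ρ n).normed volume ⋆[ContinuousLinearMap.lsmul ℝ ℝ, volume] φ
  have hsm : ∀ n, ContDiff ℝ ∞ (Φ n) := fun n =>
    (ρ n).hasCompactSupport_normed.contDiff_convolution_left _ (ρ n).contDiff_normed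
      hφ.continuous.locallyIntegrable
  have hcs : ∀ n, tsupport (Φ n) ⊆ K := fun n =>
    closure_minimal (fun x hx => by
      by_contra hxK
      exact hx (conv_zero φ subset_rfl n x hxK)) Metric.isClosed_cthickening
  have hΦ : ∀ n, IsTest U (Φ n) := fun n =>
    ⟨hsm n, hKc.of_isClosed_subset (isClosed_tsupport _) (hcs n), (hcs n).trans hδU⟩
  let φ' : E3 → ℝ := fun x => fderiv ℝ φ x (basisVec i)
  have hφ'c : Continuous φ' := (hφ.continuous_fderiv one_ne_zero).clm_apply continuous_const
  have hφ's : tsupport φ' ⊆ tsupport φ :=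
    (closure_mono fun x hx => by
      have : fderiv ℝ φ x ≠ 0 := fun h0 => hx (by simp [φ', h0])
      exact this).trans (tsupport_fderiv_subset ℝ)
  have hderiv : ∀ n x, fderiv ℝ (Φ n) x (basisVec i) =
      ((ρ n).normed volume ⋆[ContinuousLinearMap.lsmul ℝ ℝ, volume] φ') x := by
    intro n x
    have hli : LocallyIntegrable ((ρ n).normed (volume : Measure E3)) volume :=
      (ρ n).continuous_normed.locallyIntegrable
    rw [(hc.hasFDerivAt_convolution_right (ContinuousLinearMap.lsmul ℝ ℝ) hli hφ x).fderiv,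
      convolution_precompR_apply _ hli (hc.fderiv ℝ) (hφ.continuous_fderiv one_ne_zero)]
  have hconv : ∀ g : E3 → ℝ, Continuous g → tsupport g ⊆ tsupport φ → ∀ n,
      Continuous ((ρ n).normed volume ⋆[ContinuousLinearMap.lsmul ℝ ℝ, volume] g) := fun g hg hgs n =>
    ((ρ n).hasCompactSupport_normed.contDiff_convolution_left (n := 0)
      (ContinuousLinearMap.lsmul ℝ ℝ) (ρ n).contDiff_normed
      hg.locallyIntegrable).continuous
  have lim : ∀ (F : E3 → ℝ) (g : E3 → ℝ), LocallyIntegrableOn F U volume → Continuous g →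
      tsupport g ⊆ tsupport φ →
      Tendsto (fun n => ∫ x in U, F x *
        ((ρ n).normed volume ⋆[ContinuousLinearMap.lsmul ℝ ℝ, volume] g) x) atTop
        (𝓝 (∫ x in U, F x * g x)) := by
    intro F g hF hg hgs
    obtain ⟨C, hC⟩ := conv_bound g hg hgs
    exact tendsto_setIntegral_mul_of_bounded hF.aestronglyMeasurable
      (hF.integrableOn_compact_subset hδU hKc) hKc.measurableSet
      (fun n => (hconv g hg hgs n).aestronglyMeasurable) hC (conv_zero g hgs)
      fun x => ContDiffBump.convolution_tendsto_right_of_continuous hρ0 hg x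
  have h1 := lim f φ' h.1 hφ'c hφ's
  have h2 := lim f' φ h.2.1 hφ.continuous subset_rfl
  refine tendsto_nhds_unique h1 (h2.neg.congr fun n => ?_)
  rw [← h.2.2 (Φ n) (hΦ n)]
  exact integral_congr_ae (Eventually.of_forall fun x => by simp only [hderiv])

theorem setIntegral_eq_of_support {U V : Set E3} (hU : MeasurableSet U)
    (hVU : V ⊆ U) {f : E3 → ℝ} (hf : ∀ x, x ∉ V → f x = 0) : ∫ x in U, f x = ∫ x in V, f x :=
  setIntegral_eq_of_subset_of_forall_sdiff_eq_zero hU hVU fun x hx => hf x hx.2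

theorem fderiv_eq_zero_of_notMem_tsupport {V : Type*} [NormedAddCommGroup V] [NormedSpace ℝ V]
    {φ : E3 → V} {x : E3} (hx : x ∉ tsupport φ) : fderiv ℝ φ x = 0 := by
  by_contra hne
  exact hx (tsupport_fderiv_subset ℝ (subset_tsupport _ hne))

theorem IsWeakPartial.mono {U V : Set E3} (hU : IsOpen U) (hVU : V ⊆ U)
    {i : Fin 3} {f f' : E3 → ℝ} (h : IsWeakPartial U i f f') : IsWeakPartial V i f f' := by
  refine ⟨h.1.mono_set hVU, h.2.1.mono_set hVU, fun φ hφ => ?_⟩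
  have h0 : ∀ x, x ∉ V → x ∉ tsupport φ := fun x hx hx' => hx (hφ.2.2 hx')
  rw [← setIntegral_eq_of_support hU.measurableSet hVU,
    ← setIntegral_eq_of_support hU.measurableSet hVU,
    h.2.2 φ ⟨hφ.1, hφ.2.1, hφ.2.2.trans hVU⟩]
  · exact fun x hx => by rw [image_eq_zero_of_notMem_tsupport (h0 x hx), mul_zero]
  · exact fun x hx => by rw [fderiv_eq_zero_of_notMem_tsupport (h0 x hx)]; simp

theorem integrableOn_mul_of_isTest {U : Set E3} {f : E3 → ℝ} (hU : IsOpen U)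
    (hf : LocallyIntegrableOn f U volume) {g : E3 → ℝ} (hg : Continuous g) {K : Set E3}
    (hK : IsCompact K) (hKU : K ⊆ U) (h0 : ∀ x, x ∉ K → g x = 0) :
    IntegrableOn (fun x => f x * g x) U volume := by
  have h1 : IntegrableOn (fun x => f x * g x) K volume :=
    (hf.integrableOn_compact_subset hKU hK).mul_continuousOn hg.continuousOn hK
  exact h1.of_forall_sdiff_eq_zero hU.measurableSet fun x hx => by simp [h0 x hx.2]

/-- The weak derivative is almost everywhere unique. -/
theorem IsWeakPartial.ae_eq {U : Set E3} (hU : IsOpen U) {i : Fin 3} {f f₁ f₂ : E3 → ℝ}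
    (h₁ : IsWeakPartial U i f f₁) (h₂ : IsWeakPartial U i f f₂) :
    ∀ᵐ x ∂(volume.restrict U), f₁ x = f₂ x := by
  rw [ae_restrict_iff' hU.measurableSet]
  have := hU.ae_eq_zero_of_integral_contDiff_smul_eq_zero (f := fun x => f₁ x - f₂ x)
    (h₁.2.1.sub h₂.2.1) fun g hg hgc hgs => ?_
  · filter_upwards [this] with x hx hxU using sub_eq_zero.1 (hx hxU)
  have e1 := h₁.2.2 g ⟨hg, hgc, hgs⟩
  rw [h₂.2.2 g ⟨hg, hgc, hgs⟩, neg_inj] at e1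
  have i1 := integrableOn_mul_of_isTest hU h₁.2.1 hg.continuous hgc hgs
    fun x hx => image_eq_zero_of_notMem_tsupport hx
  have i2 := integrableOn_mul_of_isTest hU h₂.2.1 hg.continuous hgc hgs
    fun x hx => image_eq_zero_of_notMem_tsupport hx
  rw [← setIntegral_eq_integral_of_forall_compl_eq_zero (s := U) fun x hx => by
    rw [image_eq_zero_of_notMem_tsupport fun h => hx (hgs h), zero_smul]]
  have : ∀ x, g x • (f₁ x - f₂ x) = f₁ x * g x - f₂ x * g x := fun x => by
    rw [smul_eq_mul]; ring
  simp_rw [this]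
  rw [integral_sub i1 i2, e1, sub_self]

theorem IsWeakPartial.congr_left {U : Set E3} {i : Fin 3} {f g f' : E3 → ℝ}
    (h : IsWeakPartial U i f f') (hfg : ∀ᵐ x ∂(volume.restrict U), f x = g x)
    (hg : LocallyIntegrableOn g U volume) :
    IsWeakPartial U i g f' := by
  refine ⟨hg, h.2.1, fun φ hφ => ?_⟩
  rw [← h.2.2 φ hφ]
  refine integral_congr_ae ?_
  filter_upwards [hfg] with x hx using by rw [hx]

theorem integral_mul_fderiv_eq_neg {f g : E3 → ℝ} (hf : ContDiff ℝ 1 f) (hg : ContDiff ℝ 1 g)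
    (hgc : HasCompactSupport g) (v : E3) :
    ∫ x, f x * fderiv ℝ g x v = - ∫ x, fderiv ℝ f x v * g x := by
  have cf' : Continuous fun x => fderiv ℝ f x v :=
    (hf.continuous_fderiv one_ne_zero).clm_apply continuous_const
  have cg' : Continuous fun x => fderiv ℝ g x v :=
    (hg.continuous_fderiv one_ne_zero).clm_apply continuous_const
  have hg'c : HasCompactSupport fun x => fderiv ℝ g x v :=
    (hgc.fderiv ℝ).comp_left (g := fun L : E3 →L[ℝ] ℝ => L v) (by simp)
  refine integral_mul_fderiv_eq_neg_fderiv_mul_of_integrable ?_ ?_ ?_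
    (fun x _ => hf.differentiable one_ne_zero x) (fun x _ => hg.differentiable one_ne_zero x)
  · exact (cf'.mul hg.continuous).integrable_of_hasCompactSupport hgc.mul_left
  · exact (hf.continuous.mul cg').integrable_of_hasCompactSupport hg'c.mul_left
  · exact (hf.continuous.mul hg.continuous).integrable_of_hasCompactSupport hgc.mul_left

/-- The classical derivative of a `C¹` function is its weak derivative. -/
theorem isWeakPartial_of_contDiff {U : Set E3} (i : Fin 3) {f : E3 → ℝ}
    (hf : ContDiff ℝ 1 f) : IsWeakPartial U i f fun x => fderiv ℝ f x (basisVec i) := by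
  have cf' : Continuous fun x => fderiv ℝ f x (basisVec i) :=
    (hf.continuous_fderiv one_ne_zero).clm_apply continuous_const
  refine ⟨hf.continuous.locallyIntegrable.locallyIntegrableOn _,
    cf'.locallyIntegrable.locallyIntegrableOn _, fun φ hφ => ?_⟩
  have h0 : ∀ x, x ∉ U → x ∉ tsupport φ := fun x hx hx' => hx (hφ.2.2 hx')
  rw [setIntegral_eq_integral_of_forall_compl_eq_zero fun x hx => by
      rw [fderiv_eq_zero_of_notMem_tsupport (h0 x hx)]; simp,
    setIntegral_eq_integral_of_forall_compl_eq_zero fun x hx => by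
      rw [image_eq_zero_of_notMem_tsupport (h0 x hx), mul_zero],
    integral_mul_fderiv_eq_neg hf (hφ.1.of_le (by simp)) hφ.2.1]

theorem tendsto_integral_mul_of_tendsto_L2 {μ : Measure E3} {f g : E3 → ℝ} {F : ℕ → E3 → ℝ}
    (hf : MemLp f 2 μ) (hF : ∀ n, MemLp (F n) 2 μ) (hg : MemLp g 2 μ)
    (h : Tendsto (fun n => eLpNorm (fun x => f x - F n x) 2 μ) atTop (𝓝 0)) :
    Tendsto (fun n => ∫ x, F n x * g x ∂μ) atTop (𝓝 (∫ x, f x * g x ∂μ)) := by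
  refine tendsto_integral_of_L1' _ (hf.integrable_mul hg).aestronglyMeasurable
    (Eventually.of_forall fun n => (hF n).integrable_mul hg) ?_
  have hlim : Tendsto (fun n => eLpNorm (fun x => f x - F n x) 2 μ * eLpNorm g 2 μ) atTop (𝓝 0) := by
    simpa using ENNReal.Tendsto.mul_const h (Or.inr hg.eLpNorm_ne_top)
  refine tendsto_of_tendsto_of_tendsto_of_le_of_le tendsto_const_nhds hlim (fun _ => zero_le)
    fun n => ?_
  have e : ((fun x => F n x * g x) - f * g) =
      -((fun x => f x - F n x) • g) := by
    ext x; simp; ring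
  simp only
  rw [e, eLpNorm_neg]
  exact eLpNorm_smul_le_mul_eLpNorm (p := 2) (q := 2) (r := 1) hg.aestronglyMeasurable
    (hf.sub (hF n)).aestronglyMeasurable

theorem contDiff_coord (j : Fin 3) {n : WithTop ℕ∞} : ContDiff ℝ n fun x : E3 => x j :=
  contDiff_euclidean.1 contDiff_id j

theorem fderiv_coord {φ : E3 → E3} {x : E3} (hφ : DifferentiableAt ℝ φ x) (j : Fin 3) (v : E3) :
    fderiv ℝ (fun y => φ y j) x v = fderiv ℝ φ x v j := by
  have h := (EuclideanSpace.proj (𝕜 := ℝ) j : E3 →L[ℝ] ℝ).hasFDerivAt.comp x hφ.hasFDerivAt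
  have h2 : HasFDerivAt (fun y => φ y j)
    ((EuclideanSpace.proj (𝕜 := ℝ) j : E3 →L[ℝ] ℝ).comp (fderiv ℝ φ x)) x := h
  rw [h2.fderiv]; rfl

/-- Fields in `W^{1,2}_0` have a weak gradient which can be tested with `C¹` functions of compact
support that do not vanish on the boundary: their extension by zero is in `W^{1,2}(ℝ³)`. -/
theorem MemW120.exists_gradient {U : Set E3} {u : E3 → E3} (h : MemW120 U u) :
    ∃ Du : E3 → Fin 3 → Fin 3 → ℝ, HasW12Gradient U u Du ∧
      ∀ φ : E3 → ℝ, ContDiff ℝ 1 φ → HasCompactSupport φ → ∀ i j,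
        ∫ x in U, u x j * fderiv ℝ φ x (basisVec i) = - ∫ x in U, Du x i j * φ x := by
  obtain ⟨Du, hDu, Φ, hΦ, h0, h1⟩ := h
  refine ⟨Du, hDu, fun φ hφ hφc i j => ?_⟩
  have cφ' : Continuous fun x => fderiv ℝ φ x (basisVec i) :=
    (hφ.continuous_fderiv one_ne_zero).clm_apply continuous_const
  have hφ'c : HasCompactSupport fun x => fderiv ℝ φ x (basisVec i) :=
    (hφc.fderiv ℝ).comp_left (g := fun L : E3 →L[ℝ] ℝ => L (basisVec i)) (by simp)
  have mφ : MemLp φ 2 (volume.restrict U) :=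
    (hφ.continuous.memLp_of_hasCompactSupport hφc).restrict U
  have mφ' : MemLp (fun x => fderiv ℝ φ x (basisVec i)) 2 (volume.restrict U) :=
    (cφ'.memLp_of_hasCompactSupport hφ'c).restrict U
  have hΦ1 : ∀ n, ContDiff ℝ 1 (Φ n) := fun n => (hΦ n).1.of_le (by simp)
  have hΦj : ∀ n, ContDiff ℝ 1 fun x => Φ n x j := fun n => (contDiff_coord j).comp (hΦ1 n)
  have cΦ' : ∀ n, Continuous fun x => fderiv ℝ (Φ n) x (basisVec i) j := fun n =>
    (contDiff_coord (n := 1) j).continuous.comp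
      (((hΦ1 n).continuous_fderiv one_ne_zero).clm_apply continuous_const)
  have mΦ : ∀ n, MemLp (fun x => Φ n x j) 2 (volume.restrict U) := fun n =>
    ((hΦj n).continuous.memLp_of_hasCompactSupport
      ((hΦ n).2.1.comp_left (g := fun v : E3 => v j) rfl)).restrict U
  have mΦ' : ∀ n, MemLp (fun x => fderiv ℝ (Φ n) x (basisVec i) j) 2 (volume.restrict U) := fun n =>
    ((cΦ' n).memLp_of_hasCompactSupport
      (((hΦ n).2.1.fderiv ℝ).comp_left (g := fun L : E3 →L[ℝ] E3 => L (basisVec i) j)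
        (by simp))).restrict U
  have mu : MemLp (fun x => u x j) 2 (volume.restrict U) :=
    (EuclideanSpace.proj (𝕜 := ℝ) j : E3 →L[ℝ] ℝ).comp_memLp' hDu.1
  have lim1 := tendsto_integral_mul_of_tendsto_L2 mu mΦ mφ' <| by
    refine tendsto_of_tendsto_of_tendsto_of_le_of_le tendsto_const_nhds h0 (fun _ => zero_le)
      fun n => eLpNorm_mono fun x => ?_
    exact PiLp.norm_apply_le (u x - Φ n x) j
  have lim2 := tendsto_integral_mul_of_tendsto_L2 (hDu.2 i j).2 mΦ' mφ (h1 i j)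
  -- The approximating fields are compactly supported in U, so integrating them by parts leaves no
  -- boundary term whatever φ does on the boundary; the identity then passes to the L² limit.
  refine tendsto_nhds_unique lim1 (lim2.neg.congr fun n => ?_)
  have hz : ∀ x, x ∉ U → x ∉ tsupport (Φ n) := fun x hx hx' => hx ((hΦ n).2.2 hx')
  rw [setIntegral_eq_integral_of_forall_compl_eq_zero fun x hx => by
      rw [fderiv_eq_zero_of_notMem_tsupport (hz x hx)]; simp,
    setIntegral_eq_integral_of_forall_compl_eq_zero fun x hx => by
      rw [image_eq_zero_of_notMem_tsupport (hz x hx)]; simp,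
    integral_mul_fderiv_eq_neg (hΦj n) hφ hφc]
  simp_rw [fderiv_coord ((hΦ1 n).differentiable one_ne_zero _)]

/-- A divergence free field in `W^{1,2}_0` is divergence free in the whole space, after extension
by zero. -/
theorem integral_sum_mul_fderiv_eq_zero {U : Set E3} (hU : IsOpen U) {u : E3 → E3}
    {Du : E3 → Fin 3 → Fin 3 → ℝ} (hDu : HasW12Gradient U u Du)
    (hD : ∀ φ : E3 → ℝ, ContDiff ℝ 1 φ → HasCompactSupport φ → ∀ i j,
        ∫ x in U, u x j * fderiv ℝ φ x (basisVec i) = - ∫ x in U, Du x i j * φ x)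
    (hdiv : IsDivFree U u) {φ : E3 → ℝ} (hφ : ContDiff ℝ 1 φ) (hφc : HasCompactSupport φ) :
    ∑ i, ∫ x in U, u x i * fderiv ℝ φ x (basisVec i) = 0 := by
  have int1 : ∀ (g : E3 → ℝ), ContDiff ℝ 1 g → HasCompactSupport g → ∀ i,
      IntegrableOn (fun x => u x i * fderiv ℝ g x (basisVec i)) U volume := by
    intro g hg hgc i
    have mu : MemLp (fun x => u x i) 2 (volume.restrict U) :=
      (EuclideanSpace.proj (𝕜 := ℝ) i : E3 →L[ℝ] ℝ).comp_memLp' hDu.1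
    have cg' : Continuous fun x => fderiv ℝ g x (basisVec i) :=
      (hg.continuous_fderiv one_ne_zero).clm_apply continuous_const
    exact mu.integrable_mul (q := 2) ((cg'.memLp_of_hasCompactSupport
      ((hgc.fderiv ℝ).comp_left (g := fun L : E3 →L[ℝ] ℝ => L (basisVec i)) (by simp))).restrict U)
  have int2 : ∀ (g : E3 → ℝ), ContDiff ℝ 1 g → HasCompactSupport g → ∀ i,
      IntegrableOn (fun x => Du x i i * g x) U volume := fun g hg hgc i =>
    (hDu.2 i i).2.integrable_mul (q := 2) ((hg.continuous.memLp_of_hasCompactSupport hgc).restrict U)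
  -- Interior test functions already force the trace of the weak gradient to vanish almost
  -- everywhere; afterwards any φ may be used, including one that does not vanish on the boundary.
  have hdiv0 : ∀ᵐ x ∂volume, x ∈ U → ∑ i, Du x i i = 0 := by
    have hloc : LocallyIntegrableOn (fun x => ∑ i, Du x i i) U volume := by
      have := fun i => (hDu.2 i i).1.2.1
      simp only [Fin.sum_univ_three]
      exact ((this 0).add (this 1)).add (this 2)
    refine hU.ae_eq_zero_of_integral_contDiff_smul_eq_zero hloc fun g hg hgc hgs => ?_
    have hg1 : ContDiff ℝ 1 g := hg.of_le (by simp)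
    rw [← setIntegral_eq_integral_of_forall_compl_eq_zero (s := U) fun x hx => by
      rw [image_eq_zero_of_notMem_tsupport fun h => hx (hgs h), zero_smul]]
    have := hdiv g ⟨hg, hgc, hgs⟩
    rw [integral_finsetSum _ fun i _ => int1 g hg1 hgc i] at this
    simp_rw [hD g hg1 hgc] at this
    rw [Finset.sum_neg_distrib, neg_eq_zero, ← integral_finsetSum _ fun i _ => int2 g hg1 hgc i]
      at this
    rw [← this]
    congr 1 with x
    rw [smul_eq_mul, mul_comm, Finset.sum_mul]
  simp_rw [hD φ hφ hφc]
  rw [Finset.sum_neg_distrib, neg_eq_zero, ← integral_finsetSum _ fun i _ => int2 φ hφ hφc i]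
  simp_rw [← Finset.sum_mul]
  refine integral_eq_zero_of_ae ?_
  rw [EventuallyEq, ae_restrict_iff' hU.measurableSet]
  filter_upwards [hdiv0] with x hx hxU
  rw [hx hxU]; simp

/-! ### Horizontal and vertical coordinates -/

/-- The point with horizontal part `y` and third coordinate `t`. -/
def pt (y : E2) (t : ℝ) : E3 := !₂[y 0, y 1, t]

@[simp] theorem pt_zero (y : E2) (t : ℝ) : pt y t 0 = y 0 := rfl
@[simp] theorem pt_one (y : E2) (t : ℝ) : pt y t 1 = y 1 := rfl
@[simp] theorem pt_two (y : E2) (t : ℝ) : pt y t 2 = t := rfl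

@[simp] theorem horiz_pt (y : E2) (t : ℝ) : horiz (pt y t) = y := by
  ext i; fin_cases i <;> rfl

@[simp] theorem pt_horiz (x : E3) : pt (horiz x) (x 2) = x := by
  ext i; fin_cases i <;> rfl

@[simp] theorem horiz_zero (x : E3) : horiz x 0 = x 0 := rfl
@[simp] theorem horiz_one (x : E3) : horiz x 1 = x 1 := rfl

theorem norm_sq_eq (x : E3) : ‖x‖ ^ 2 = ‖horiz x‖ ^ 2 + x 2 ^ 2 := by
  simp [EuclideanSpace.norm_sq_eq, Fin.sum_univ_three, Fin.sum_univ_two]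

theorem pt_sub (y z : E2) (t s : ℝ) : pt y t - pt z s = pt (y - z) (t - s) := by
  ext i; fin_cases i <;> rfl

theorem pt_eq_add (y : E2) (t : ℝ) : pt y t = pt y 0 + t • basisVec 2 := by
  ext i; fin_cases i <;> simp [pt, basisVec]

theorem norm_pt_zero_left (t : ℝ) : ‖pt 0 t‖ = |t| := by
  rw [← Real.sqrt_sq (norm_nonneg _), norm_sq_eq]
  simp [Real.sqrt_sq_eq_abs]

theorem dist_pt (y : E2) (t s : ℝ) : dist (pt y t) (pt y s) = |t - s| := by
  rw [dist_eq_norm, pt_sub, sub_self, norm_pt_zero_left]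

theorem inner_basisVec (i : Fin 3) (x : E3) : inner ℝ (basisVec i) x = x i := by
  simp [basisVec, EuclideanSpace.inner_single_left]

@[fun_prop]
theorem contDiff_pt {n : WithTop ℕ∞} : ContDiff ℝ n fun p : E2 × ℝ => pt p.1 p.2 := by
  rw [contDiff_euclidean]
  intro i
  fin_cases i
  · exact (contDiff_euclidean.1 contDiff_fst 0)
  · exact (contDiff_euclidean.1 contDiff_fst 1)
  · exact contDiff_snd

@[fun_prop]
theorem contDiff_horiz {n : WithTop ℕ∞} : ContDiff ℝ n horiz := by
  rw [contDiff_euclidean]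
  intro i
  fin_cases i
  · exact contDiff_coord 0
  · exact contDiff_coord 1

theorem continuous_pt_right (y : E2) : Continuous (pt y) :=
  (contDiff_pt (n := 0)).continuous.comp (by fun_prop : Continuous fun t : ℝ => (y, t))

/-! ### Graphs in vertical position -/

theorem eventually_pos_lt {α : ℝ} (hα : 0 < α) : ∀ᶠ t in 𝓝[>] (0 : ℝ), 0 < t ∧ t < α :=
  (eventually_mem_nhdsWithin (a := (0 : ℝ)) (s := Ioi 0)).and
    (eventually_nhdsWithin_of_eventually_nhds (eventually_lt_nhds hα))

variable {k K σ₀ : ℝ} {D : Set E3} {R : E3 ≃ᵃⁱ[ℝ] E3} {g : E2 → ℝ}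

theorem norm_horiz_le (x : E3) : ‖horiz x‖ ≤ ‖x‖ := by
  have := norm_sq_eq x
  nlinarith [norm_nonneg x, norm_nonneg (horiz x), sq_nonneg (x 2)]

theorem horiz_smul (t : ℝ) (x : E3) : horiz (t • x) = t • horiz x := by
  ext i; fin_cases i <;> rfl

theorem AffineIsometryEquiv.apply_eq (R : E3 ≃ᵃⁱ[ℝ] E3) (z : E3) :
    R z = R 0 + R.linearIsometryEquiv z := by
  have := R.map_vadd 0 z
  simpa [add_comm] using this

theorem symm_apply_two (L : E3 ≃ₗᵢ[ℝ] E3) (v : E3) :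
    L.symm v 2 = inner ℝ (L (basisVec 2)) v := by
  rw [← inner_basisVec 2, ← L.inner_map_map, L.apply_symm_apply]

/-- Rays from the base point which enter the upper half space stay in `D` for a short time, rays
which enter the lower half space stay outside. -/
theorem IsC3Graph.eventually_mem (hg : IsC3Graph k K σ₀ D R g) (hk : 0 < k) (hσ : 0 < σ₀) (v : E3) :
    (0 < inner ℝ (R.linearIsometryEquiv (basisVec 2)) v →
      ∀ᶠ t in 𝓝[>] (0 : ℝ), R 0 + t • v ∈ D) ∧
    (inner ℝ (R.linearIsometryEquiv (basisVec 2)) v < 0 →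
      ∀ᶠ t in 𝓝[>] (0 : ℝ), R 0 + t • v ∉ D) := by
  set L := R.linearIsometryEquiv with hL
  rw [← symm_apply_two]
  set z := L.symm v with hz
  have hR : ∀ t : ℝ, R 0 + t • v = R (t • z) := fun t => by
    rw [AffineIsometryEquiv.apply_eq R (t • z), map_smul, hz, ← hL, L.apply_symm_apply]
  -- In the local frame the ray has height t z₃ while the graph over it is O(t²), so the sign of z₃
  -- decides for small t.
  have key : ∀ t : ℝ, 0 < t → t < σ₀ / (1 + ‖z‖) → t < k * σ₀ ^ 2 / (1 + |z 2|) →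
      |g (horiz (t • z))| ≤ t * (t * (k * ‖z‖ ^ 2)) ∧
      (R 0 + t • v ∈ D ↔ g (horiz (t • z)) < t * z 2) := by
    intro t ht h1 h2
    rw [lt_div_iff₀ (by positivity)] at h1 h2
    have h3 : ‖horiz (t • z)‖ ≤ t * ‖z‖ := by
      rw [horiz_smul, norm_smul, Real.norm_of_nonneg ht.le]
      exact mul_le_mul_of_nonneg_left (norm_horiz_le z) ht.le
    have h4 : ‖horiz (t • z)‖ < σ₀ := by nlinarith
    refine ⟨(hg.abs_le _ h4).trans ?_, ?_⟩
    · calc k * ‖horiz (t • z)‖ ^ 2 ≤ k * (t * ‖z‖) ^ 2 := by gcongr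
        _ = _ := by ring
    · rw [hR, hg.mem_iff _ h4]
      · rfl
      · change |t * z 2| < _
        rw [abs_mul, abs_of_pos ht]
        nlinarith
  have ev : ∀ α : ℝ, 0 < α → ∀ᶠ t in 𝓝[>] (0 : ℝ), 0 < t ∧ t < σ₀ / (1 + ‖z‖) ∧
      t < k * σ₀ ^ 2 / (1 + |z 2|) ∧ t < α / (1 + k * ‖z‖ ^ 2) := by
    intro α hα
    filter_upwards [eventually_pos_lt (show 0 < σ₀ / (1 + ‖z‖) by positivity),
      eventually_pos_lt (show 0 < k * σ₀ ^ 2 / (1 + |z 2|) by positivity),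
      eventually_pos_lt (show 0 < α / (1 + k * ‖z‖ ^ 2) by positivity)] with t h1 h2 h3
    exact ⟨h1.1, h1.2, h2.2, h3.2⟩
  constructor
  · intro hpos
    filter_upwards [ev _ hpos] with t ⟨ht, h1, h2, h3⟩
    obtain ⟨h4, h5⟩ := key t ht h1 h2
    rw [h5]
    rw [lt_div_iff₀ (by positivity)] at h3
    refine (le_abs_self _).trans_lt (h4.trans_lt ?_)
    exact mul_lt_mul_of_pos_left (by linarith) ht
  · intro hneg
    filter_upwards [ev _ (neg_pos.2 hneg)] with t ⟨ht, h1, h2, h3⟩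
    obtain ⟨h4, h5⟩ := key t ht h1 h2
    rw [h5, not_lt]
    rw [lt_div_iff₀ (by positivity)] at h3
    have := mul_lt_mul_of_pos_left (show t * (k * ‖z‖ ^ 2) < - z 2 by linarith) ht
    linarith [neg_abs_le (g (horiz (t • z)))]

/-- Strict Cauchy-Schwarz. If two candidate normals differ, the direction n - e points inward for
one and outward for the other; this is the contradiction in both normal-matching lemmas. -/
theorem inner_sub_pos_of_ne {n e : E3} (hn : ‖n‖ = 1) (he : ‖e‖ = 1) (hne : n ≠ e) :
    0 < inner ℝ n (n - e) ∧ inner ℝ e (n - e) < 0 := by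
  have h1 : inner ℝ n e < 1 := by
    refine lt_of_le_of_ne ?_ fun h => hne ?_
    · simpa [hn, he] using real_inner_le_norm n e
    · exact (inner_eq_one_iff_of_norm_eq_one hn he).1 h
  rw [inner_sub_right, inner_sub_right, real_inner_self_eq_norm_sq, real_inner_self_eq_norm_sq,
    hn, he, real_inner_comm n e]
  constructor <;> linarith

theorem IsC3Graph.map_basisVec_of_isInnerNormal (hg : IsC3Graph k K σ₀ D R g) (hk : 0 < k)
    (hσ : 0 < σ₀) {x : E3} (hx : R 0 = x) (hn : IsInnerNormal D x (basisVec 2)) :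
    R.linearIsometryEquiv (basisVec 2) = basisVec 2 := by
  by_contra hne
  obtain ⟨h1, h2⟩ := inner_sub_pos_of_ne
    (by rw [R.linearIsometryEquiv.norm_map, norm_basisVec]) (norm_basisVec 2) hne
  have e1 := (hg.eventually_mem hk hσ _).1 h1
  have e2 := hn (-(R.linearIsometryEquiv (basisVec 2) - basisVec 2)) (by rw [inner_neg_right]; linarith)
  obtain ⟨t, ht1, ht2⟩ := (e1.and e2).exists
  rw [hx] at ht1
  refine ht2.2 ?_
  rwa [smul_neg, sub_neg_eq_add]

/-- Taylor expansion of the odd part along the ray through z: the even orders cancel, the linear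
term vanishes because the gradient is zero at the origin, and the cubic remainder is controlled by
the third derivative. -/
theorem IsC3Graph.abs_sub_neg_le (hg : IsC3Graph k K σ₀ D R g) {z : E2} (hz : ‖z‖ < σ₀) :
    |g z - g (-z)| ≤ 2 * K * ‖z‖ ^ 3 := by
  let q : ℕ → ℝ → ℝ := fun m t => iteratedFDeriv ℝ m g (t • z) fun _ => z
  have hball : ∀ t : ℝ, |t| ≤ 1 → ‖t • z‖ < σ₀ := fun t ht => by
    rw [norm_smul, Real.norm_eq_abs]
    nlinarith [norm_nonneg z]
  have hq : ∀ m : ℕ, m < 3 → ∀ t : ℝ, |t| ≤ 1 → HasDerivAt (q m) (q (m + 1) t) t := by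
    intro m hm t ht
    have hc : ContDiffAt ℝ 3 g (t • z) := hg.contDiffOn.contDiffAt
      (Metric.isOpen_ball.mem_nhds (by simpa using hball t ht))
    have hd : DifferentiableAt ℝ (iteratedFDeriv ℝ m g) (t • z) :=
      (hc.iteratedFDeriv_right (m := 1) (i := m) (by exact_mod_cast (by omega : 1 + m ≤ 3))
        ).differentiableAt one_ne_zero
    have h1 : HasDerivAt (fun s : ℝ => s • z) z t := by
      simpa using (hasDerivAt_id t).smul_const z
    have h2 := hd.hasFDerivAt.comp_hasDerivAt t h1
    have h3 := ((ContinuousMultilinearMap.apply ℝ (fun _ : Fin m => E2) ℝ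
      (fun _ => z)).hasFDerivAt.comp_hasDerivAt t h2)
    exact h3
  have hq3 : ∀ t : ℝ, |t| ≤ 1 → |q 3 t| ≤ K * ‖z‖ ^ 3 := fun t ht => by
    have := (iteratedFDeriv ℝ 3 g (t • z)).le_of_opNorm_le (hg.norm_three_le _ (hball t ht))
      (fun _ => z)
    simpa using this
  have hq1 : q 1 0 = 0 := by
    have h0 := hg.norm_le 1 (by norm_num) 0 (by simpa using (norm_nonneg z).trans_lt hz)
    have h1 := (iteratedFDeriv ℝ 1 g 0).le_of_opNorm_le h0 (fun _ => z)
    simp only [q, zero_smul]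
    simpa using h1
  have hneg : ∀ m : ℕ, m < 3 → ∀ t : ℝ, |t| ≤ 1 →
      HasDerivAt (fun s => q m (-s)) (-q (m + 1) (-t)) t := fun m hm t ht => by
    exact ((hq m hm (-t) (by rwa [abs_neg])).scomp t (hasDerivAt_neg t)).congr_deriv (by simp)
  have mvt : ∀ (f f' : ℝ → ℝ) (C : ℝ), 0 ≤ C → f 0 = 0 →
      (∀ t : ℝ, |t| ≤ 1 → HasDerivAt f (f' t) t) →
      (∀ t ∈ Icc (0 : ℝ) 1, |f' t| ≤ C) → ∀ t ∈ Icc (0 : ℝ) 1, |f t| ≤ C := by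
    intro f f' C hC h0 hd hb t ht
    have := (convex_Icc (0 : ℝ) 1).norm_image_sub_le_of_norm_hasDerivWithin_le (f := f) (f' := f')
      (C := C) (fun x hx => (hd x (_root_.abs_le.2 ⟨by linarith [hx.1], hx.2⟩)).hasDerivWithinAt)
      (fun x hx => hb x hx) (left_mem_Icc.2 zero_le_one) ht
    rw [h0, sub_zero, sub_zero, Real.norm_eq_abs, Real.norm_of_nonneg ht.1] at this
    nlinarith [ht.2]
  have hK : 0 ≤ K * ‖z‖ ^ 3 := (abs_nonneg _).trans (hq3 0 (by simp))
  have habs : ∀ t ∈ Icc (0 : ℝ) 1, |t| ≤ 1 := fun t ht => _root_.abs_le.2 ⟨by linarith [ht.1], ht.2⟩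
  -- Three successive mean value estimates, from the third derivative down to g itself. Each
  -- function in the chain vanishes at t = 0: two by symmetry, the middle one by `hq1`.
  have b2 := mvt (fun t => q 2 t - q 2 (-t)) (fun t => q 3 t + q 3 (-t)) (2 * (K * ‖z‖ ^ 3))
    (by positivity) (by simp) (fun t ht => by
      exact ((hq 2 (by norm_num) t ht).sub (hneg 2 (by norm_num) t ht)).congr_deriv (by ring))
    (fun t ht => by
      have h1 := hq3 t (habs t ht)
      have h2 := hq3 (-t) (by rw [abs_neg]; exact habs t ht)
      linarith [abs_add_le (q 3 t) (q 3 (-t))])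
  have b1 := mvt (fun t => q 1 t + q 1 (-t)) (fun t => q 2 t - q 2 (-t)) (2 * (K * ‖z‖ ^ 3))
    (by positivity) (by simp [hq1]) (fun t ht => by
      exact ((hq 1 (by norm_num) t ht).add (hneg 1 (by norm_num) t ht)).congr_deriv (by ring)) b2
  have b0 := mvt (fun t => q 0 t - q 0 (-t)) (fun t => q 1 t + q 1 (-t)) (2 * (K * ‖z‖ ^ 3))
    (by positivity) (by simp) (fun t ht => by
      exact ((hq 0 (by norm_num) t ht).sub (hneg 0 (by norm_num) t ht)).congr_deriv (by ring)) b1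
  have := b0 1 (by simp)
  simp only [q, one_smul, neg_smul, iteratedFDeriv_zero_apply] at this
  linarith

/-- A domain whose frame at `(0, 0, s)` is vertical is, near that point, the region above a graph
over the horizontal plane. -/
theorem IsC3Graph.exists_vertical (hg : IsC3Graph k K σ₀ D R g) (hσ : 0 < σ₀)
    {s : ℝ} (hR : R 0 = pt 0 s) (hL : R.linearIsometryEquiv (basisVec 2) = basisVec 2) :
    ∃ G : E2 → ℝ, ContDiff ℝ 1 G ∧ ∀ y, ‖y‖ < 3 * σ₀ / 4 →
      |G y| ≤ k * ‖y‖ ^ 2 ∧ |G y - G (-y)| ≤ 2 * K * ‖y‖ ^ 3 ∧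
      ∀ t, |t - s| < k * σ₀ ^ 2 → (pt y t ∈ D ↔ s + G y < t) := by
  set L := R.linearIsometryEquiv with hLdef
  -- As L fixes the vertical axis, its inverse maps the horizontal plane isometrically to itself.
  -- The given frame thus differs from the vertical one only by this horizontal isometry.
  let N : E2 → E2 := fun y => horiz (L.symm (pt y 0))
  have hNc : ContDiff ℝ 1 N := contDiff_horiz.comp (L.symm.contDiff.comp
    (contDiff_pt.comp (contDiff_id.prodMk contDiff_const)))
  have hN2 : ∀ y, (L.symm (pt y 0)) 2 = 0 := fun y => by
    rw [symm_apply_two, hL, inner_basisVec, pt_two]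
  have hNn : ∀ y, ‖N y‖ = ‖y‖ := fun y => by
    have h1 := norm_sq_eq (L.symm (pt y 0))
    rw [hN2, L.symm.norm_map, norm_sq_eq] at h1
    simp only [horiz_pt, pt_two] at h1
    have h2 : ‖N y‖ ^ 2 = ‖y‖ ^ 2 := by linarith
    exact (pow_left_inj₀ (norm_nonneg _) (norm_nonneg _) two_ne_zero).1 h2
  have hNneg : ∀ y, N (-y) = -N y := fun y => by
    have : pt (-y) 0 = -pt y 0 := by ext i; fin_cases i <;> simp [pt]
    simp only [N, this, map_neg]
    ext i; fin_cases i <;> rfl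
  -- The graph function is controlled only on the disc of radius σ₀. This bump makes it globally C¹
  -- without changing it on the smaller disc of radius 3σ₀/4, which still contains the discs of
  -- radius at most σ₀/2 used later.
  let β : ContDiffBump (0 : E2) := ⟨3 * σ₀ / 4, 7 * σ₀ / 8, by positivity, by linarith⟩
  have hβ : ∀ y, ‖y‖ < 3 * σ₀ / 4 → β y = 1 := fun y hy =>
    β.one_of_mem_closedBall (by simpa [β] using hy.le)
  refine ⟨fun y => β (N y) * g (N y), ?_, fun y hy => ?_⟩
  · refine ContDiff.comp (g := fun z => β z * g z) ?_ hNc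
    refine contDiff_iff_contDiffAt.2 fun z => ?_
    by_cases hz : z ∈ Metric.ball (0 : E2) σ₀
    · exact β.contDiffAt.mul ((hg.contDiffOn.contDiffAt (Metric.isOpen_ball.mem_nhds hz)).of_le
        (by norm_num))
    · have hz' : z ∈ (Metric.closedBall (0 : E2) (7 * σ₀ / 8))ᶜ := fun h =>
        hz (Metric.closedBall_subset_ball (by linarith) h)
      refine (contDiffAt_const (c := (0 : ℝ))).congr_of_eventuallyEq ?_
      filter_upwards [Metric.isClosed_closedBall.isOpen_compl.mem_nhds hz'] with w hw
      rw [image_eq_zero_of_notMem_tsupport (f := β) (by rwa [β.tsupport_eq]), zero_mul]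
  · have hy' : ‖N y‖ < σ₀ := by rw [hNn]; linarith
    simp only [hNneg]
    rw [hβ (N y) (by rwa [hNn]), hβ (-N y) (by rwa [norm_neg, hNn]), one_mul, one_mul]
    refine ⟨?_, ?_, fun t ht => ?_⟩
    · rw [← hNn y]; exact hg.abs_le _ hy'
    · rw [← hNn y]; exact hg.abs_sub_neg_le hy'
    · have hz : L.symm (pt y (t - s)) = L.symm (pt y 0) + (t - s) • basisVec 2 := by
        rw [pt_eq_add, map_add, map_smul]
        congr 2
        rw [LinearIsometryEquiv.symm_apply_eq, hL]
      have hh : horiz (L.symm (pt y (t - s))) = N y := by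
        rw [hz]
        ext i; fin_cases i <;> simp [N, horiz, basisVec]
      have h2 : (L.symm (pt y (t - s))) 2 = t - s := by
        rw [symm_apply_two, hL, inner_basisVec, pt_two]
      have hmem := hg.mem_iff (L.symm (pt y (t - s))) (by rwa [hh]) (by rwa [h2])
      rw [hh, h2, AffineIsometryEquiv.apply_eq R, hR, ← hLdef, L.apply_symm_apply] at hmem
      have hpt : pt 0 s + pt y (t - s) = pt y t := by
        ext i; fin_cases i <;> simp [pt]
      rw [hpt] at hmem
      rw [hmem]
      constructor <;> intro <;> linarith

/-! ### The gap between the body and the container -/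

/-- Over the disc `‖y‖ < r`, the fluid near the closest points fills the region between the graphs
of `a` and `h + b`; it has the exterior of `Ω` below and the body `S` above, up to the depth `H`. -/
structure IsGap (k K h r H : ℝ) (S Ω : Set E3) (a b : E2 → ℝ) : Prop where
  contDiff_bottom : ContDiff ℝ 1 a
  contDiff_top : ContDiff ℝ 1 b
  abs_bottom_le : ∀ y, ‖y‖ < r → |a y| ≤ k * ‖y‖ ^ 2
  abs_top_le : ∀ y, ‖y‖ < r → |b y| ≤ k * ‖y‖ ^ 2
  bottom_odd_le : ∀ y, ‖y‖ < r → |a y - a (-y)| ≤ 2 * K * ‖y‖ ^ 3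
  top_odd_le : ∀ y, ‖y‖ < r → |b y - b (-y)| ≤ 2 * K * ‖y‖ ^ 3
  bottom_le_top : ∀ y, ‖y‖ < r → a y ≤ h + b y
  mem_fluid : ∀ y, ‖y‖ < r → ∀ t, a y < t → t < h + b y → pt y t ∈ fluid S Ω
  notMem : ∀ y, ‖y‖ < r → ∀ t, -H < t → t ≤ a y → pt y t ∉ Ω
  mem_body : ∀ y, ‖y‖ < r → ∀ t, h + b y < t → t < h + H → pt y t ∈ S

variable {S Ω : Set E3} {h : ℝ}

theorem setDist_le_dist {A B : Set E3} {x y : E3} (hx : x ∈ closure A) (hy : y ∈ B) :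
    setDist A B ≤ dist x y := by
  have h1 : ∀ s ∈ A, setDist A B ≤ dist s y := fun s hs =>
    csInf_le ⟨0, by rintro _ ⟨p, _, q, _, rfl⟩; exact dist_nonneg⟩ ⟨s, hs, y, hy, rfl⟩
  exact closure_minimal (t := {s | setDist A B ≤ dist s y}) h1
    (isClosed_le continuous_const (continuous_id.dist continuous_const)) hx

theorem setDist_nonneg (A B : Set E3) : 0 ≤ setDist A B :=
  Real.sInf_nonneg (by rintro _ ⟨p, _, q, _, rfl⟩; exact dist_nonneg)

theorem inter_frontier_nonempty {X : Type*} [TopologicalSpace X] {s t : Set X}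
    (hs : IsPreconnected s) (h1 : (s ∩ t).Nonempty) (h2 : (s ∩ tᶜ).Nonempty) :
    (s ∩ frontier t).Nonempty := by
  by_contra hne
  rw [not_nonempty_iff_eq_empty] at hne
  have hno : ∀ x ∈ s, x ∈ closure t → x ∈ interior t := fun x hx hc => by
    by_contra hi
    exact (hne ▸ (⟨hx, hc, hi⟩ : x ∈ s ∩ frontier t) : x ∈ (∅ : Set X))
  obtain ⟨x, hx, hxt⟩ := h1
  obtain ⟨y, hy, hyt⟩ := h2
  obtain ⟨z, -, hz1, hz2⟩ := hs (interior t) (closure t)ᶜ isOpen_interior isClosed_closure.isOpen_compl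
    (fun z hz => or_iff_not_imp_right.2 fun hc => hno z hz (not_not.1 hc))
    ⟨x, hx, hno x hx (subset_closure hxt)⟩ ⟨y, hy, fun hc => hyt (interior_subset (hno y hy hc))⟩
  exact hz2 (subset_closure (interior_subset hz1))

/-- A segment from a point of S to a point outside Ω must cross the boundary of Ω, and it would do
so closer to S than the distance allows. -/
theorem mem_of_dist_lt_setDist (hSΩ : S ⊆ Ω) {s x : E3} (hs : s ∈ closure S)
    (hx : dist s x < setDist S (frontier Ω)) : x ∈ Ω := by
  by_contra hxΩ
  obtain ⟨s', hs', hd⟩ := Metric.mem_closure_iff.1 hs _ (sub_pos.2 hx)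
  have hd' : dist x s' < setDist S (frontier Ω) := by
    have := dist_triangle x s s'
    rw [dist_comm x s] at this
    linarith
  obtain ⟨z, hz, hzf⟩ := inter_frontier_nonempty (convex_segment (𝕜 := ℝ) s' x).isPreconnected
    ⟨s', left_mem_segment ℝ s' x, hSΩ hs'⟩ ⟨x, right_mem_segment ℝ s' x, hxΩ⟩
  have hzb := (convex_ball s' (setDist S (frontier Ω))).segment_subset
    (Metric.mem_ball_self (dist_nonneg.trans_lt hd')) hd' hz
  rw [Metric.mem_ball, dist_comm] at hzb
  exact absurd (setDist_le_dist (subset_closure hs') hzf) (not_le.2 hzb)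

theorem pt_zero_eq_smul (h : ℝ) : pt 0 h = h • basisVec 2 := by
  rw [pt_eq_add]
  have : pt 0 0 = 0 := by ext i; fin_cases i <;> rfl
  rw [this, zero_add]

/-- The body and the container have the same inner normal at the closest points. -/
theorem IsC3Graph.map_basisVec_of_closest {k K σ₀ : ℝ} {R : E3 ≃ᵃⁱ[ℝ] E3} {g : E2 → ℝ}
    (hg : IsC3Graph k K σ₀ S R g) (hk : 0 < k) (hσ : 0 < σ₀) (hSΩ : S ⊆ Ω)
    (hh : h = setDist S (frontier Ω)) (h0 : (0 : E3) ∈ frontier Ω)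
    (hR : R 0 = pt 0 h) (hn : IsInnerNormal Ω 0 (basisVec 2)) :
    R.linearIsometryEquiv (basisVec 2) = basisVec 2 := by
  by_contra hne
  obtain ⟨h1, h2⟩ := inner_sub_pos_of_ne
    (by rw [R.linearIsometryEquiv.norm_map, norm_basisVec]) (norm_basisVec 2) hne
  set v := R.linearIsometryEquiv (basisVec 2) - basisVec 2 with hv
  have e1 := (hg.eventually_mem hk hσ _).1 h1
  rw [hR, pt_zero_eq_smul] at e1
  have hh0 : 0 ≤ h := hh ▸ setDist_nonneg _ _
  -- If h = 0 the body touches the container at Q, and the ray along v would enter S while leaving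
  -- Ω. If h > 0, moving from P along v enters S and also decreases the distance to Q, against
  -- minimality.
  rcases hh0.eq_or_lt with hz | hpos
  · have e2 := hn (-v) (by rw [inner_neg_right]; linarith)
    obtain ⟨t, ht1, ht2⟩ := (e1.and e2).exists
    rw [← hz, zero_smul] at ht1
    refine ht2.2 ?_
    rw [smul_neg, sub_neg_eq_add]
    exact hSΩ ht1
  -- For t below this threshold the quadratic term t²|v|² is beaten by the negative linear term
  -- 2ht⟨e₃, v⟩ in the expansion of |h e₃ + t v|².
  · have hα : 0 < -(2 * h * inner ℝ (basisVec 2) v) / (1 + ‖v‖ ^ 2) := by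
      apply div_pos _ (by positivity)
      nlinarith
    obtain ⟨t, ht1, ht0, ht2⟩ := (e1.and (eventually_pos_lt hα)).exists
    have hd := setDist_le_dist (subset_closure ht1) h0
    rw [← hh, dist_zero_right] at hd
    have hn2 := norm_add_sq_real (h • basisVec 2) (t • v)
    rw [inner_smul_left, inner_smul_right, norm_smul, norm_smul, norm_basisVec,
      Real.norm_of_nonneg hh0, Real.norm_of_nonneg ht0.le] at hn2
    simp only [conj_trivial] at hn2
    rw [lt_div_iff₀ (by positivity)] at ht2
    have h3 := mul_lt_mul_of_pos_left ht2 ht0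
    have h4 : h ^ 2 ≤ ‖h • basisVec 2 + t • v‖ ^ 2 := by gcongr
    nlinarith

/-- Each graph describes its set only within vertical distance kσ₀² of the base point, whereas h may
be larger. In the uncovered middle range, membership in the fluid follows from h being the distance
between S and the boundary of Ω. -/
theorem exists_isGap {k K σ₀ : ℝ} (hk : 0 < k) (hσ : 0 < σ₀) (hΩo : IsOpen Ω)
    (hSΩ : S ⊆ Ω) (hΩ : UniformlyC3 k K σ₀ Ω)
    (hS : UniformlyC3 k K σ₀ S) (hh : h = setDist S (frontier Ω)) (h0 : (0 : E3) ∈ frontier Ω)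
    (hP : pt 0 h ∈ frontier S) (hn : IsInnerNormal Ω 0 (basisVec 2)) :
    ∃ a b : E2 → ℝ, IsGap k K h (3 * σ₀ / 4) (k * σ₀ ^ 2) S Ω a b := by
  obtain ⟨R₁, g₁, hR₁, hg₁⟩ := hΩ 0 h0
  obtain ⟨R₂, g₂, hR₂, hg₂⟩ := hS _ hP
  have hpt0 : pt 0 0 = 0 := by ext i; fin_cases i <;> rfl
  obtain ⟨a, ha, ha'⟩ := hg₁.exists_vertical hσ (s := 0) (by rw [hR₁, hpt0])
    (hg₁.map_basisVec_of_isInnerNormal hk hσ hR₁ hn)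
  obtain ⟨b, hb, hb'⟩ := hg₂.exists_vertical hσ hR₂
    (hg₂.map_basisVec_of_closest hk hσ hSΩ hh h0 hR₂ hn)
  simp only [sub_zero, zero_add] at ha'
  have hh0 : 0 ≤ h := hh ▸ setDist_nonneg _ _
  have hsq : ∀ y : E2, ‖y‖ < 3 * σ₀ / 4 → k * ‖y‖ ^ 2 < k * σ₀ ^ 2 := fun y hy => by
    have : ‖y‖ < σ₀ := by linarith
    gcongr
  have hle : ∀ y, ‖y‖ < 3 * σ₀ / 4 → a y ≤ h + b y := by
    intro y hy
    have h1 := abs_le.1 (ha' y hy).1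
    have h2 := abs_le.1 (hb' y hy).1
    have h3 := hsq y hy
    by_contra hlt
    push Not at hlt
    obtain ⟨t, ht1, ht2⟩ := exists_between hlt
    have m1 : pt y t ∈ S := ((hb' y hy).2.2 t (by rw [abs_lt]; constructor <;> linarith)).2 ht1
    have m2 := ((ha' y hy).2.2 t (by rw [abs_lt]; constructor <;> linarith)).1 (hSΩ m1)
    linarith
  have mem_closure_above : ∀ (T : Set E3) (y : E2) (s δ : ℝ), 0 < δ →
      (∀ t, s < t → t < s + δ → pt y t ∈ T) → pt y s ∈ closure T := by
    intro T y s δ hδ hT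
    refine mem_closure_of_tendsto (f := fun t => pt y t) (b := 𝓝[>] s)
      ((continuous_pt_right y).continuousAt.mono_left nhdsWithin_le_nhds) ?_
    filter_upwards [Ioo_mem_nhdsGT (show s < s + δ by linarith)] with t ht using hT t ht.1 ht.2
  refine ⟨a, b, ha, hb, fun y hy => (ha' y hy).1, fun y hy => (hb' y hy).1,
    fun y hy => (ha' y hy).2.1, fun y hy => (hb' y hy).2.1, hle, ?_, ?_, ?_⟩
  · intro y hy t ht1 ht2
    have h1 := abs_le.1 (ha' y hy).1
    have h2 := abs_le.1 (hb' y hy).1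
    have h3 := hsq y hy
    constructor
    · by_cases htk : t < k * σ₀ ^ 2
      · exact ((ha' y hy).2.2 t (by rw [abs_lt]; constructor <;> linarith)).2 ht1
      -- Here t ≥ kσ₀² > b y, so the point lies at distance h + b y - t < h below the closure of S.
      · refine mem_of_dist_lt_setDist hSΩ (s := pt y (h + b y)) ?_ ?_
        · exact mem_closure_above S y _ (k * σ₀ ^ 2 - b y) (by linarith) fun t' ht1' ht2' =>
            ((hb' y hy).2.2 t' (by rw [abs_lt]; constructor <;> linarith)).2 ht1'
        · rw [dist_pt, ← hh, abs_lt]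
          constructor <;> linarith
    · by_cases htk : h - k * σ₀ ^ 2 < t
      · intro hcl
        have hopen : IsOpen {x : E3 | ‖horiz x‖ < 3 * σ₀ / 4 ∧ h - k * σ₀ ^ 2 < x 2 ∧
            x 2 < h + b (horiz x)} := by
          have c1 : Continuous horiz := (contDiff_horiz (n := 0)).continuous
          have c2 : Continuous fun x : E3 => x 2 := (contDiff_coord (n := 0) 2).continuous
          exact (isOpen_lt c1.norm continuous_const).inter ((isOpen_lt continuous_const c2).inter
            (isOpen_lt c2 (continuous_const.add (hb.continuous.comp c1))))
        obtain ⟨x, ⟨hx1, hx2, hx3⟩, hxS⟩ := mem_closure_iff.1 hcl _ hopen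
          (show pt y t ∈ _ by simp only [mem_ofPred_eq, horiz_pt, pt_two]; exact ⟨hy, htk, ht2⟩)
        have h4 := abs_le.1 (hb' _ hx1).1
        have h5 := hsq _ hx1
        have := ((hb' _ hx1).2.2 (x 2) (by rw [abs_lt]; constructor <;> linarith)).1
          (by rwa [pt_horiz])
        linarith
      · intro hcl
        -- Here t ≤ h - kσ₀², so the point is at distance t - a y < h from this boundary point of Ω
        -- and cannot lie in the closure of S.
        have hfr : pt y (a y) ∈ frontier Ω := by
          rw [hΩo.frontier_eq]
          refine ⟨mem_closure_above Ω y _ (k * σ₀ ^ 2 - a y) (by linarith) fun t' ht1' ht2' =>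
            ((ha' y hy).2.2 t' (by rw [abs_lt]; constructor <;> linarith)).2 ht1', fun hm => ?_⟩
          exact lt_irrefl _ (((ha' y hy).2.2 (a y) (by rw [abs_lt]; constructor <;> linarith)).1 hm)
        have := setDist_le_dist hcl hfr
        rw [← hh, dist_pt, abs_of_pos (by linarith)] at this
        linarith
  · intro y hy t ht1 ht2 hm
    have h1 := abs_le.1 (ha' y hy).1
    have h3 := hsq y hy
    have := ((ha' y hy).2.2 t (by rw [abs_lt]; constructor <;> linarith)).1 hm
    linarith
  · intro y hy t ht1 ht2
    have h2 := abs_le.1 (hb' y hy).1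
    have h3 := hsq y hy
    exact ((hb' y hy).2.2 t (by rw [abs_lt]; constructor <;> linarith)).2 ht1

/-! ### Integration in horizontal and vertical coordinates -/

/-- The coordinates `pt` as a measurable equivalence. -/
def ptEquiv : E2 × ℝ ≃ᵐ E3 where
  toFun p := pt p.1 p.2
  invFun x := (horiz x, x 2)
  left_inv p := by simp
  right_inv x := by simp
  measurable_toFun := (contDiff_pt (n := 0)).continuous.measurable
  measurable_invFun := ((contDiff_horiz (n := 0)).continuous.prodMk
    (contDiff_coord (n := 0) 2).continuous).measurable

theorem measurePreserving_pt : MeasurePreserving (fun p : E2 × ℝ => pt p.1 p.2) := by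
  have h1 : MeasurePreserving (fun p : E2 × ℝ => (p.2, p.1.ofLp))
      (volume : Measure (E2 × ℝ)) (volume : Measure (ℝ × (Fin 2 → ℝ))) :=
    ((MeasurePreserving.id volume).prod (PiLp.volume_preserving_ofLp (Fin 2))).comp
      Measure.measurePreserving_swap
  have h2 := (volume_preserving_piFinSuccAbove (fun _ : Fin 3 => ℝ) 2).symm
  have h3 := (PiLp.volume_preserving_toLp (Fin 3)).comp (h2.comp h1)
  have e : (fun p : E2 × ℝ => pt p.1 p.2) = WithLp.toLp 2 ∘
      (MeasurableEquiv.piFinSuccAbove (fun _ : Fin 3 => ℝ) 2).symm ∘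
        fun p : E2 × ℝ => (p.2, p.1.ofLp) := by
    funext p
    ext i
    fin_cases i <;> rfl
  rw [e]
  exact h3

theorem measurePreserving_ptEquiv : MeasurePreserving ptEquiv := measurePreserving_pt

/-- The region over the disc `‖y‖ < σ` between the graphs of `lo` and `hi`. -/
def slab (σ : ℝ) (lo hi : E2 → ℝ) : Set E3 :=
  {x | ‖horiz x‖ < σ ∧ lo (horiz x) < x 2 ∧ x 2 < hi (horiz x)}

theorem isOpen_slab {σ : ℝ} {lo hi : E2 → ℝ} (hlo : Continuous lo) (hhi : Continuous hi) :
    IsOpen (slab σ lo hi) := by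
  have c1 : Continuous horiz := (contDiff_horiz (n := 0)).continuous
  have c2 : Continuous fun x : E3 => x 2 := (contDiff_coord (n := 0) 2).continuous
  exact (isOpen_lt c1.norm continuous_const).inter
    ((isOpen_lt (hlo.comp c1) c2).inter (isOpen_lt c2 (hhi.comp c1)))

theorem slab_subset_compact {σ : ℝ} {lo hi : E2 → ℝ} (hlo : Continuous lo) (hhi : Continuous hi) :
    ∃ K, IsCompact K ∧ slab σ lo hi ⊆ K := by
  obtain ⟨m, hm⟩ := ((isCompact_closedBall (0 : E2) σ).image hlo).bddBelow
  obtain ⟨M, hM⟩ := ((isCompact_closedBall (0 : E2) σ).image hhi).bddAbove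
  refine ⟨_, ((isCompact_closedBall (0 : E2) σ).prod (isCompact_Icc (a := m) (b := M))).image
    (contDiff_pt (n := 0)).continuous, fun x hx => ⟨(horiz x, x 2), ⟨?_, ?_, ?_⟩, pt_horiz x⟩⟩
  · simpa using hx.1.le
  · exact (hm ⟨horiz x, by simpa using hx.1.le, rfl⟩).trans hx.2.1.le
  · exact hx.2.2.le.trans (hM ⟨horiz x, by simpa using hx.1.le, rfl⟩)

theorem Continuous.integrableOn_slab {σ : ℝ} {lo hi : E2 → ℝ} (hlo : Continuous lo)
    (hhi : Continuous hi) {f : E3 → ℝ} (hf : Continuous f) : IntegrableOn f (slab σ lo hi) := by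
  obtain ⟨K, hK, hs⟩ := slab_subset_compact (σ := σ) hlo hhi
  exact (hf.continuousOn.integrableOn_compact hK).mono_set hs

theorem setIntegral_slab {σ : ℝ} {lo hi : E2 → ℝ} (hlo : Continuous lo) (hhi : Continuous hi)
    (hle : ∀ y, ‖y‖ < σ → lo y ≤ hi y) {f : E3 → ℝ} (hf : IntegrableOn f (slab σ lo hi)) :
    ∫ x in slab σ lo hi, f x =
      ∫ y in Metric.ball (0 : E2) σ, ∫ t in (lo y)..(hi y), f (pt y t) := by
  have hm := (isOpen_slab (σ := σ) hlo hhi).measurableSet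
  rw [← integral_indicator hm, ← measurePreserving_ptEquiv.integral_comp',
    Measure.volume_eq_prod, integral_prod, ← integral_indicator Metric.isOpen_ball.measurableSet]
  · congr 1 with y
    by_cases hy : ‖y‖ < σ
    · rw [indicator_of_mem (by simpa using hy), intervalIntegral.integral_of_le (hle y hy),
        integral_Ioc_eq_integral_Ioo, ← integral_indicator measurableSet_Ioo]
      congr 1 with t
      refine indicator_eq_indicator ?_ rfl
      simp [ptEquiv, slab, hy]
    · rw [indicator_of_notMem (by simpa using hy)]
      refine integral_eq_zero_of_ae (Eventually.of_forall fun t => ?_)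
      refine indicator_of_notMem (fun hx => hy ?_) _
      simpa [ptEquiv, slab] using hx.1
  · rw [← Measure.volume_eq_prod]
    exact (measurePreserving_ptEquiv.integrable_comp_emb ptEquiv.measurableEmbedding).2
      ((integrable_indicator_iff hm).2 hf)

theorem setIntegral_slab_of_hasDerivAt {σ : ℝ} {lo hi : E2 → ℝ} (hlo : Continuous lo)
    (hhi : Continuous hi) (hle : ∀ y, ‖y‖ < σ → lo y ≤ hi y) {F F' : E3 → ℝ} (hF' : Continuous F')
    (hd : ∀ y t, HasDerivAt (fun t => F (pt y t)) (F' (pt y t)) t) :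
    ∫ x in slab σ lo hi, F' x =
      ∫ y in Metric.ball (0 : E2) σ, (F (pt y (hi y)) - F (pt y (lo y))) := by
  rw [setIntegral_slab hlo hhi hle (Continuous.integrableOn_slab hlo hhi hF')]
  congr 1 with y
  exact intervalIntegral.integral_eq_sub_of_hasDerivAt (fun t _ => hd y t)
    ((hF'.comp (continuous_pt_right y)).intervalIntegrable _ _)

theorem volume_graph_eq_zero {c : E2 → ℝ} (hc : Continuous c) :
    volume {x : E3 | x 2 = c (horiz x)} = 0 := by
  have c1 : Continuous horiz := (contDiff_horiz (n := 0)).continuous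
  have c2 : Continuous fun x : E3 => x 2 := (contDiff_coord (n := 0) 2).continuous
  have hm : MeasurableSet {x : E3 | x 2 = c (horiz x)} :=
    (isClosed_eq c2 (hc.comp c1)).measurableSet
  rw [← measurePreserving_pt.measure_preimage hm.nullMeasurableSet, Measure.volume_eq_prod,
    Measure.measure_prod_null (measurePreserving_pt.measurable hm)]
  refine Eventually.of_forall fun y => ?_
  have : Prod.mk y ⁻¹' ((fun p : E2 × ℝ => pt p.1 p.2) ⁻¹' {x : E3 | x 2 = c (horiz x)}) = {c y} := by
    ext t; simp
  simp only [this, measure_singleton, Pi.zero_apply]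

theorem setIntegral_ball_neg (σ : ℝ) (f : E2 → ℝ) :
    ∫ y in Metric.ball (0 : E2) σ, f (-y) = ∫ y in Metric.ball (0 : E2) σ, f y := by
  have := (Measure.measurePreserving_neg (volume : Measure E2)).setIntegral_preimage_emb
    (MeasurableEquiv.neg E2).measurableEmbedding f (Metric.ball (0 : E2) σ)
  have hb : (Neg.neg ⁻¹' Metric.ball (0 : E2) σ) = Metric.ball (0 : E2) σ := by
    ext y; simp
  rwa [hb] at this

theorem setIntegral_ball_eq_zero_of_odd {σ : ℝ} {f : E2 → ℝ} (hf : ∀ y, f (-y) = -f y) :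
    ∫ y in Metric.ball (0 : E2) σ, f y = 0 := by
  have := setIntegral_ball_neg σ f
  simp_rw [hf, integral_neg] at this
  linarith

/-! ### A radial profile -/

/-- A smooth radial function on the plane which is positive exactly on the disc of radius `σ`. -/
noncomputable def profile (σ : ℝ) (y : E2) : ℝ := expNegInvGlue (1 - ‖y‖ ^ 2 / σ ^ 2)

/-- The radial factor of the gradient of `profile σ`: the gradient at `y` is `slope σ y • y`. -/
noncomputable def slope (σ : ℝ) (y : E2) : ℝ :=
  -(2 / σ ^ 2) * ((1 - ‖y‖ ^ 2 / σ ^ 2)⁻¹ ^ 2 * expNegInvGlue (1 - ‖y‖ ^ 2 / σ ^ 2))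

theorem hasDerivAt_expNegInvGlue (s : ℝ) :
    HasDerivAt expNegInvGlue (s⁻¹ ^ 2 * expNegInvGlue s) s := by
  simpa using expNegInvGlue.hasDerivAt_polynomial_eval_inv_mul 1 s

theorem contDiff_profile (σ : ℝ) : ContDiff ℝ 1 (profile σ) := by
  have h : ContDiff ℝ 1 expNegInvGlue := expNegInvGlue.contDiff (n := 1)
  exact h.comp (contDiff_const.sub ((contDiff_norm_sq ℝ).div_const _))

theorem contDiff_slope (σ : ℝ) : ContDiff ℝ 1 (slope σ) := by
  have h : ContDiff ℝ 1 fun s : ℝ => s⁻¹ ^ 2 * expNegInvGlue s := by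
    have := expNegInvGlue.contDiff_polynomial_eval_inv_mul (n := 1) (Polynomial.X ^ 2)
    simp only [Polynomial.eval_pow, Polynomial.eval_X] at this
    exact this
  exact contDiff_const.mul (h.comp (contDiff_const.sub ((contDiff_norm_sq ℝ).div_const _)))

theorem profile_neg (σ : ℝ) (y : E2) : profile σ (-y) = profile σ y := by simp [profile]
theorem slope_neg (σ : ℝ) (y : E2) : slope σ (-y) = slope σ y := by simp [slope]

theorem hasFDerivAt_profile (σ : ℝ) (y : E2) :
    HasFDerivAt (profile σ) (slope σ y • innerSL ℝ y) y := by
  have h1 : HasFDerivAt (fun y : E2 => ‖y‖ ^ 2) (2 • innerSL ℝ y) y :=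
    (hasStrictFDerivAt_norm_sq y).hasFDerivAt
  have h2 := (hasDerivAt_expNegInvGlue (1 - ‖y‖ ^ 2 / σ ^ 2)).comp_hasFDerivAt y
    ((h1.mul_const (σ ^ 2)⁻¹).const_sub 1)
  refine h2.congr_fderiv ?_
  ext v
  simp [slope]
  ring

theorem profile_eq_zero {σ : ℝ} (hσ : 0 < σ) {y : E2} (hy : σ ≤ ‖y‖) : profile σ y = 0 := by
  refine expNegInvGlue.zero_of_nonpos ?_
  rw [sub_nonpos, one_le_div (by positivity)]
  gcongr

theorem slope_eq_zero {σ : ℝ} (hσ : 0 < σ) {y : E2} (hy : σ ≤ ‖y‖) : slope σ y = 0 := by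
  have := profile_eq_zero hσ hy
  rw [profile] at this
  rw [slope, this]; simp

theorem profile_nonneg (σ : ℝ) (y : E2) : 0 ≤ profile σ y := expNegInvGlue.nonneg _

/-- With x = 1/s, the function x² exp(-x) is largest at x = 2; the tangent inequality for exp,
applied at x/2 - 1 and squared, gives this sharp bound. -/
theorem inv_sq_mul_expNegInvGlue_le (s : ℝ) :
    s⁻¹ ^ 2 * expNegInvGlue s ≤ 4 * Real.exp (-2) := by
  rcases le_or_gt s 0 with hs | hs
  · rw [expNegInvGlue.zero_of_nonpos hs, mul_zero]; positivity
  · rw [expNegInvGlue, if_neg hs.not_ge]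
    set x := s⁻¹ with hx
    have hx0 : 0 < x := inv_pos.2 hs
    have h1 : x / 2 ≤ Real.exp (x / 2 - 1) := by linarith [Real.add_one_le_exp (x / 2 - 1)]
    have h2 : (x / 2) ^ 2 ≤ Real.exp (x - 2) := by
      calc (x / 2) ^ 2 ≤ Real.exp (x / 2 - 1) ^ 2 := by gcongr
        _ = Real.exp (x - 2) := by rw [← Real.exp_nat_mul]; congr 1; push_cast; ring
    calc x ^ 2 * Real.exp (-x) = 4 * ((x / 2) ^ 2 * Real.exp (-x)) := by ring
      _ ≤ 4 * (Real.exp (x - 2) * Real.exp (-x)) := by gcongr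
      _ = 4 * Real.exp (-2) := by rw [← Real.exp_add]; congr 2; ring

theorem abs_slope_mul_norm_le {σ : ℝ} (hσ : 0 < σ) (y : E2) :
    |slope σ y| * ‖y‖ ≤ 8 * Real.exp (-2) / σ := by
  rcases le_or_gt σ ‖y‖ with hy | hy
  · rw [slope_eq_zero hσ hy, abs_zero, zero_mul]; positivity
  · have h0 : 0 ≤ (1 - ‖y‖ ^ 2 / σ ^ 2)⁻¹ ^ 2 * expNegInvGlue (1 - ‖y‖ ^ 2 / σ ^ 2) :=
      mul_nonneg (sq_nonneg _) (expNegInvGlue.nonneg _)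
    rw [slope, abs_mul, abs_neg, abs_of_pos (by positivity), abs_of_nonneg h0]
    calc 2 / σ ^ 2 * ((1 - ‖y‖ ^ 2 / σ ^ 2)⁻¹ ^ 2 * expNegInvGlue (1 - ‖y‖ ^ 2 / σ ^ 2)) * ‖y‖
        ≤ 2 / σ ^ 2 * (4 * Real.exp (-2)) * σ := by
          gcongr ?_ * ?_
          exact mul_le_mul_of_nonneg_left (inv_sq_mul_expNegInvGlue_le _) (by positivity)
      _ = _ := by field_simp; ring

/-- On the disc of radius σ/√2, which has half the area, the argument of the profile is at least 1/2
and the profile is at least exp(-2). The same factor exp(-2) occurs in `abs_slope_mul_norm_le`, so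
it cancels in the final estimate. -/
theorem le_integral_profile {σ : ℝ} (hσ : 0 < σ) :
    Real.exp (-2) * Real.pi * σ ^ 2 / 2 ≤ ∫ y in Metric.ball (0 : E2) σ, profile σ y := by
  have hs2 : Real.sqrt 2 ^ 2 = 2 := Real.sq_sqrt (by norm_num)
  have h1 : (1 : ℝ) ≤ Real.sqrt 2 := Real.one_le_sqrt.2 (by norm_num)
  set ρ := σ / Real.sqrt 2 with hρ
  have hρ0 : 0 < ρ := by positivity
  have hρσ : ρ ≤ σ := div_le_self hσ.le h1
  have hρ2 : ρ ^ 2 = σ ^ 2 / 2 := by rw [hρ, div_pow, hs2]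
  have hint : IntegrableOn (profile σ) (Metric.ball (0 : E2) σ) :=
    ((contDiff_profile σ).continuous.continuousOn.integrableOn_compact
      (isCompact_closedBall (0 : E2) σ)).mono_set Metric.ball_subset_closedBall
  calc Real.exp (-2) * Real.pi * σ ^ 2 / 2 = ∫ _y in Metric.ball (0 : E2) ρ, Real.exp (-2) := by
        rw [setIntegral_const, smul_eq_mul, measureReal_def, EuclideanSpace.volume_ball_fin_two,
          ENNReal.toReal_mul, ENNReal.toReal_pow, ENNReal.toReal_ofReal hρ0.le,
          ENNReal.toReal_ofReal Real.pi_pos.le, hρ2]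
        ring
    _ ≤ ∫ y in Metric.ball (0 : E2) ρ, profile σ y := by
        refine setIntegral_mono_on (integrableOn_const (by
          rw [EuclideanSpace.volume_ball_fin_two]; finiteness))
          (hint.mono_set (Metric.ball_subset_ball hρσ)) Metric.isOpen_ball.measurableSet ?_
        intro y hy
        have hy' : ‖y‖ < ρ := by simpa using hy
        have h2 : ‖y‖ ^ 2 / σ ^ 2 ≤ 1 / 2 := by
          rw [div_le_div_iff₀ (by positivity) (by norm_num)]
          have : ‖y‖ ^ 2 ≤ ρ ^ 2 := by gcongr
          linarith
        calc Real.exp (-2) = expNegInvGlue (1 / 2) := by norm_num [expNegInvGlue]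
          _ ≤ profile σ y := expNegInvGlue.monotone (by linarith)
    _ ≤ _ := setIntegral_mono_set hint (Eventually.of_forall fun y => profile_nonneg σ y)
        (Metric.ball_subset_ball hρσ).eventuallyLE

/-! ### Integration by parts between two graphs -/

theorem hasDerivAt_slice {f : E3 → ℝ} (hf : Differentiable ℝ f) (y : E2) (t : ℝ) :
    HasDerivAt (fun t => f (pt y t)) (fderiv ℝ f (pt y t) (basisVec 2)) t := by
  have h1 : HasDerivAt (fun t => pt y t) (basisVec 2) t := by
    have := ((hasDerivAt_id t).smul_const (basisVec 2)).const_add (pt y 0)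
    simp only [id, one_smul] at this
    exact this.congr_of_eventuallyEq (Eventually.of_forall fun s => pt_eq_add y s)
  exact (hf (pt y t)).hasFDerivAt.comp_hasDerivAt t h1

theorem fderiv_basisVec_two_eq {f : E3 → ℝ} (hf : Differentiable ℝ f) {x : E3} {d : ℝ}
    (hd : HasDerivAt (fun t => f (pt (horiz x) t)) d (x 2)) :
    fderiv ℝ f x (basisVec 2) = d := by
  have := hasDerivAt_slice hf (horiz x) (x 2)
  rw [pt_horiz] at this
  exact this.unique hd

/-- A continuous ramp from `0` to `1` on `[1 / (n + 1), 2 / (n + 1)]`. -/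
noncomputable def ramp (n : ℕ) (s : ℝ) : ℝ := max 0 (min 1 ((n + 1) * s - 1))

/-- The primitive of `ramp n`, a `C¹` approximation of the positive part. -/
noncomputable def rampPrim (n : ℕ) (s : ℝ) : ℝ := ∫ t in (0 : ℝ)..s, ramp n t

theorem continuous_ramp (n : ℕ) : Continuous (ramp n) := by unfold ramp; fun_prop

theorem ramp_nonneg (n : ℕ) (s : ℝ) : 0 ≤ ramp n s := le_max_left _ _

theorem abs_ramp_le (n : ℕ) (s : ℝ) : |ramp n s| ≤ 1 := by
  rw [abs_of_nonneg (ramp_nonneg n s)]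
  exact max_le zero_le_one (min_le_left _ _)

theorem ramp_eq_zero {n : ℕ} {s : ℝ} (hs : s ≤ 1 / (n + 1)) : ramp n s = 0 := by
  rw [le_div_iff₀ (by positivity)] at hs
  exact max_eq_left ((min_le_right _ _).trans (by linarith))

theorem tendsto_ramp {s : ℝ} (hs : 0 < s) : Tendsto (fun n => ramp n s) atTop (𝓝 1) := by
  refine tendsto_const_nhds.congr' ?_
  obtain ⟨N, hN⟩ := exists_nat_gt (2 / s)
  filter_upwards [eventually_ge_atTop N] with n hn
  rw [div_lt_iff₀ hs] at hN
  have : (N : ℝ) ≤ n := by exact_mod_cast hn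
  rw [ramp, min_eq_left (by nlinarith), max_eq_right zero_le_one]

theorem hasDerivAt_rampPrim (n : ℕ) (s : ℝ) : HasDerivAt (rampPrim n) (ramp n s) s :=
  (continuous_ramp n).integral_hasStrictDerivAt 0 s |>.hasDerivAt

theorem contDiff_rampPrim (n : ℕ) : ContDiff ℝ 1 (rampPrim n) := by
  rw [contDiff_one_iff_deriv]
  refine ⟨fun s => (hasDerivAt_rampPrim n s).differentiableAt, ?_⟩
  have : deriv (rampPrim n) = ramp n := funext fun s => (hasDerivAt_rampPrim n s).deriv
  rw [this]
  exact continuous_ramp n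

theorem rampPrim_eq_zero {n : ℕ} {s : ℝ} (hs : s ≤ 1 / (n + 1)) : rampPrim n s = 0 := by
  refine intervalIntegral.integral_zero_ae (Eventually.of_forall fun t ht => ramp_eq_zero ?_)
  rw [mem_uIoc] at ht
  have : (0 : ℝ) ≤ 1 / (n + 1) := by positivity
  rcases ht with ht | ht <;> linarith [ht.2]

theorem abs_rampPrim_le (n : ℕ) (s : ℝ) : |rampPrim n s| ≤ |s| := by
  have := intervalIntegral.norm_integral_le_of_norm_le_const (a := 0) (b := s) (f := ramp n) (C := 1)
    fun t _ => abs_ramp_le n t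
  simpa [rampPrim] using this

theorem tendsto_rampPrim {s : ℝ} (hs : 0 < s) : Tendsto (fun n => rampPrim n s) atTop (𝓝 s) := by
  have h1 : s = ∫ _t in (0 : ℝ)..s, (1 : ℝ) := by simp
  conv_rhs => rw [h1]
  refine intervalIntegral.tendsto_integral_filter_of_dominated_convergence (fun _ => 1) ?_ ?_ ?_ ?_
  · exact Eventually.of_forall fun n => (continuous_ramp n).aestronglyMeasurable
  · exact Eventually.of_forall fun n => Eventually.of_forall fun t _ => abs_ramp_le n t
  · simp
  · refine Eventually.of_forall fun t ht => tendsto_ramp ?_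
    rw [uIoc_of_le hs.le] at ht
    exact ht.1

/-- Vertical integration by parts between two graphs, against a test function which vanishes on
both of them: no boundary values of `f` enter. -/
theorem IsWeakPartial.integral_slab {F : Set E3} (hF : IsOpen F) {f f' : E3 → ℝ}
    (h : IsWeakPartial F 2 f f') {σ : ℝ} {lo hi e : E2 → ℝ} (hlo : ContDiff ℝ 1 lo)
    (hhi : ContDiff ℝ 1 hi) (he : ContDiff ℝ 1 e) (he0 : ∀ y, σ ≤ ‖y‖ → e y = 0)
    (hle : ∀ y, ‖y‖ ≤ σ → lo y ≤ hi y)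
    (hmem : ∀ y, ‖y‖ ≤ σ → ∀ t, lo y < t → t < hi y → pt y t ∈ F)
    (hf : IntegrableOn f (slab σ lo hi)) (hf' : IntegrableOn f' (slab σ lo hi)) :
    ∫ x in slab σ lo hi, f x * (e (horiz x) * (lo (horiz x) + hi (horiz x) - 2 * x 2)) =
      - ∫ x in slab σ lo hi, f' x *
        (e (horiz x) * ((x 2 - lo (horiz x)) * (hi (horiz x) - x 2))) := by
  have c1 : ContDiff ℝ 1 horiz := contDiff_horiz
  have c2 : ContDiff ℝ 1 fun x : E3 => x 2 := contDiff_coord 2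
  set G := slab σ lo hi with hG
  have hGm : MeasurableSet G := (isOpen_slab hlo.continuous hhi.continuous).measurableSet
  obtain ⟨K, hK, hGK⟩ := slab_subset_compact (σ := σ + 1) hlo.continuous hhi.continuous
  have hGK' : G ⊆ K := fun x hx => hGK ⟨by linarith [hx.1], hx.2⟩
  have hGF : G ⊆ F := fun x hx => by
    have := hmem _ hx.1.le _ hx.2.1 hx.2.2
    rwa [pt_horiz] at this
  let p : E3 → ℝ := fun x => (x 2 - lo (horiz x)) * (hi (horiz x) - x 2)
  let m : E3 → ℝ := fun x => lo (horiz x) + hi (horiz x) - 2 * x 2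
  have hp : ContDiff ℝ 1 p := (c2.sub (hlo.comp c1)).mul ((hhi.comp c1).sub c2)
  have hm : ContDiff ℝ 1 m := ((hlo.comp c1).add (hhi.comp c1)).sub (contDiff_const.mul c2)
  have hec : ContDiff ℝ 1 fun x => e (horiz x) := he.comp c1
  have hbetween : ∀ x, ‖horiz x‖ ≤ σ → 0 < p x → lo (horiz x) < x 2 ∧ x 2 < hi (horiz x) := by
    intro x hx hpx
    have := hle _ hx
    rcases mul_pos_iff.1 hpx with h1 | h1
    · exact ⟨by linarith [h1.1], by linarith [h1.2]⟩
    · linarith [h1.1, h1.2]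
  have hppos : ∀ x ∈ G, 0 < p x := fun x hx =>
    mul_pos (sub_pos.2 hx.2.1) (sub_pos.2 hx.2.2)
  -- Over the disc p is positive exactly between the graphs: `lo ≤ hi` excludes that both factors
  -- are negative. Truncating p therefore localizes to G even where the graphs touch.
  have hoff : ∀ x, x ∉ G → e (horiz x) = 0 ∨ p x ≤ 0 := by
    intro x hx
    by_contra! hne
    have hlt : ‖horiz x‖ < σ := lt_of_not_ge fun hge => hne.1 (he0 _ hge)
    exact hx ⟨hlt, hbetween x hlt.le hne.2⟩
  have hn0 : ∀ n : ℕ, (0 : ℝ) ≤ 1 / (n + 1) := fun n => by positivity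
  -- The weight e·p vanishes on the graphs but is not compactly supported inside F. Replacing p by
  -- `rampPrim n (p x)` removes the set p ≤ 1/(n + 1), giving admissible C¹ test functions,
  -- dominated by e·p in absolute value.
  let η : ℕ → E3 → ℝ := fun n x => e (horiz x) * rampPrim n (p x)
  let η' : ℕ → E3 → ℝ := fun n x => e (horiz x) * (ramp n (p x) * m x)
  have hη : ∀ n, ContDiff ℝ 1 (η n) := fun n => hec.mul ((contDiff_rampPrim n).comp hp)
  have hη' : ∀ n x, fderiv ℝ (η n) x (basisVec 2) = η' n x := by
    intro n x
    refine fderiv_basisVec_two_eq ((hη n).differentiable one_ne_zero) ?_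
    have hpd : HasDerivAt (fun t => p (pt (horiz x) t)) (m x) (x 2) := by
      simp only [p, m, horiz_pt, pt_two]
      exact (((hasDerivAt_id (x 2)).sub_const (lo (horiz x))).mul
        ((hasDerivAt_id (x 2)).const_sub (hi (horiz x)))).congr_deriv (by simp; ring)
    have := ((hasDerivAt_rampPrim n (p (pt (horiz x) (x 2)))).comp (x 2) hpd).const_mul (e (horiz x))
    rw [pt_horiz] at this
    refine this.congr_of_eventuallyEq (Eventually.of_forall fun t => ?_)
    simp [η]
  have hsupp : ∀ n, tsupport (η n) ⊆ {x | ‖horiz x‖ ≤ σ ∧ 1 / ((n : ℝ) + 1) ≤ p x} := by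
    intro n
    refine closure_minimal (fun x hx => ?_) ?_
    · have hx' : e (horiz x) ≠ 0 ∧ rampPrim n (p x) ≠ 0 := mul_ne_zero_iff.1 hx
      exact ⟨le_of_not_ge fun hge => hx'.1 (he0 _ hge),
        le_of_not_ge fun hge => hx'.2 (rampPrim_eq_zero hge)⟩
    · exact (isClosed_le c1.continuous.norm continuous_const).inter
        (isClosed_le continuous_const hp.continuous)
  have hsupp_pos : ∀ n, ∀ x ∈ tsupport (η n), ‖horiz x‖ ≤ σ ∧ 0 < p x := fun n x hx =>
    ⟨(hsupp n hx).1, (by positivity : (0 : ℝ) < 1 / (n + 1)).trans_le (hsupp n hx).2⟩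
  have hηF : ∀ n, tsupport (η n) ⊆ F := fun n x hx => by
    obtain ⟨h1, h2⟩ := hsupp_pos n x hx
    have := hmem _ h1 _ (hbetween x h1 h2).1 (hbetween x h1 h2).2
    rwa [pt_horiz] at this
  have hηc : ∀ n, HasCompactSupport (η n) := fun n => by
    refine hK.of_isClosed_subset (isClosed_tsupport _) fun x hx => hGK ?_
    obtain ⟨h1, h2⟩ := hsupp_pos n x hx
    exact ⟨by linarith, hbetween x h1 h2⟩
  have hη0 : ∀ n x, x ∉ G → η n x = 0 := fun n x hx => by
    rcases hoff x hx with h0 | h0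
    · simp [η, h0]
    · simp [η, rampPrim_eq_zero (h0.trans (hn0 n))]
  have hη'0 : ∀ n x, x ∉ G → η' n x = 0 := fun n x hx => by
    rcases hoff x hx with h0 | h0
    · simp [η', h0]
    · simp [η', ramp_eq_zero (h0.trans (hn0 n))]
  have key : ∀ n, ∫ x in G, f x * η' n x = - ∫ x in G, f' x * η n x := by
    intro n
    rw [← setIntegral_eq_of_support hF.measurableSet hGF fun x hx => by rw [hη'0 n x hx, mul_zero],
      ← setIntegral_eq_of_support hF.measurableSet hGF fun x hx => by rw [hη0 n x hx, mul_zero],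
      ← h.integral_mul_fderiv hF (hη n) (hηc n) (hηF n)]
    simp_rw [hη']
  obtain ⟨C₁, hC₁⟩ := hK.exists_bound_of_continuousOn (hec.mul hm).continuous.continuousOn
  obtain ⟨C₂, hC₂⟩ := hK.exists_bound_of_continuousOn (hec.mul hp).continuous.continuousOn
  have lim1 := tendsto_setIntegral_mul_of_bounded hf.aestronglyMeasurable hf hGm
    (F := η') (G := G.indicator fun x => e (horiz x) * m x) (C := max C₁ 0)
    (fun n => (hec.continuous.mul (((continuous_ramp n).comp hp.continuous).mul
      hm.continuous)).aestronglyMeasurable)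
    (fun n x => by
      by_cases hx : x ∈ G
      · refine (le_trans ?_ (hC₁ x (hGK' hx))).trans (le_max_left _ _)
        have := abs_ramp_le n (p x)
        simp only [η', Real.norm_eq_abs, abs_mul]
        have h3 := mul_le_of_le_one_left (abs_nonneg (m x)) this
        exact mul_le_mul_of_nonneg_left h3 (abs_nonneg _)
      · rw [hη'0 n x hx, abs_zero]; exact le_max_right _ _)
    hη'0 (fun x => by
      by_cases hx : x ∈ G
      · rw [indicator_of_mem hx]
        simpa using ((tendsto_ramp (hppos x hx)).mul_const (m x)).const_mul (e (horiz x))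
      · rw [indicator_of_notMem hx]
        exact tendsto_const_nhds.congr fun n => (hη'0 n x hx).symm)
  have lim2 := tendsto_setIntegral_mul_of_bounded hf'.aestronglyMeasurable hf' hGm
    (F := η) (G := G.indicator fun x => e (horiz x) * p x) (C := max C₂ 0)
    (fun n => (hη n).continuous.aestronglyMeasurable)
    (fun n x => by
      by_cases hx : x ∈ G
      · refine (le_trans ?_ (hC₂ x (hGK' hx))).trans (le_max_left _ _)
        simp only [η, Real.norm_eq_abs, abs_mul]
        exact mul_le_mul_of_nonneg_left (abs_rampPrim_le n (p x)) (abs_nonneg _)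
      · rw [hη0 n x hx, abs_zero]; exact le_max_right _ _)
    hη0 (fun x => by
      by_cases hx : x ∈ G
      · rw [indicator_of_mem hx]
        exact (tendsto_rampPrim (hppos x hx)).const_mul (e (horiz x))
      · rw [indicator_of_notMem hx]
        exact tendsto_const_nhds.congr fun n => (hη0 n x hx).symm)
  have huniq := tendsto_nhds_unique lim1 (lim2.neg.congr fun n => (key n).symm)
  have hind : ∀ q w : E3 → ℝ, ∫ x in G, q x * G.indicator w x = ∫ x in G, q x * w x := fun q w =>
    setIntegral_congr_fun hGm fun x hx => by simp only [indicator_of_mem hx]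
  rw [hind, hind] at huniq
  exact huniq

/-- Near the closest points, the container is made of the gap and the body. -/
theorem IsGap.setIntegral_eq_add {k K h r H σ : ℝ} {S Ω : Set E3} {a b : E2 → ℝ}
    (hg : IsGap k K h r H S Ω a b) (hSΩ : S ⊆ Ω) (hσ : σ ≤ r) (hΩ : IsOpen Ω)
    {f : E3 → ℝ} (hf : IntegrableOn f Ω)
    (hf0 : ∀ x, σ ≤ ‖horiz x‖ ∨ x 2 ≤ -H ∨ h + H ≤ x 2 → f x = 0) :
    ∫ x in Ω, f x = (∫ x in slab σ a (fun y => h + b y), f x) +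
      ∫ x in slab σ (fun y => h + b y) (fun _ => h + H), f x := by
  have ca := hg.contDiff_bottom.continuous
  have cb : Continuous fun y => h + b y := continuous_const.add hg.contDiff_top.continuous
  have m1 := (isOpen_slab (σ := σ) ca cb).measurableSet
  have m2 := (isOpen_slab (σ := σ) cb (continuous_const (y := h + H))).measurableSet
  have s1 : slab σ a (fun y => h + b y) ⊆ Ω := fun x hx => by
    have := (hg.mem_fluid _ (hx.1.trans_le hσ) _ hx.2.1 hx.2.2).1
    rwa [pt_horiz] at this
  have s2 : slab σ (fun y => h + b y) (fun _ => h + H) ⊆ Ω := fun x hx => hSΩ <| by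
    have := hg.mem_body _ (hx.1.trans_le hσ) _ hx.2.1 hx.2.2
    rwa [pt_horiz] at this
  rw [← setIntegral_union _ m2 (hf.mono_set s1) (hf.mono_set s2)]
  · refine setIntegral_eq_of_subset_of_ae_sdiff_eq_zero hΩ.measurableSet.nullMeasurableSet
      (union_subset s1 s2) ?_
    -- Inside the cylinder, Ω consists of the two slabs and part of the null graph of h + b, since
    -- at or below the graph of a there are no points of Ω.
    have hnull := compl_mem_ae_iff.2 (volume_graph_eq_zero cb)
    filter_upwards [hnull] with x hx hxd
    refine hf0 x ?_
    by_contra! hcon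
    have hne : x 2 ≠ h + b (horiz x) := hx
    have ha : a (horiz x) < x 2 := by
      by_contra! hle
      refine hg.notMem _ (hcon.1.trans_le hσ) _ hcon.2.1 hle ?_
      rw [pt_horiz]
      exact hxd.1
    rcases lt_or_gt_of_ne hne with hlt | hgt
    · exact hxd.2 (Or.inl ⟨hcon.1, ha, hlt⟩)
    · exact hxd.2 (Or.inr ⟨hcon.1, hgt, hcon.2.2⟩)
  · rw [disjoint_left]
    intro x hx1 hx2
    exact lt_asymm hx1.2.2 hx2.2.1

/-- Recentring at P makes the rotation pivot vanish there. The w₃ part is then tangential to circles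
about the axis, so it carries no flux through radial profiles. -/
theorem rigidVelocity_components (v w c x : E3) (h : ℝ) :
    rigidVelocity v w c x 0 =
        rigidVelocity v w c (pt 0 h) 0 + (w 1 * (x 2 - h) - w 2 * x 1) ∧
      rigidVelocity v w c x 1 =
        rigidVelocity v w c (pt 0 h) 1 + (w 2 * x 0 - w 0 * (x 2 - h)) ∧
      rigidVelocity v w c x 2 =
        rigidVelocity v w c (pt 0 h) 2 + (w 0 * x 1 - w 1 * x 0) := by
  refine ⟨?_, ?_, ?_⟩ <;> simp [rigidVelocity, cross, crossProduct] <;> ring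

theorem contDiff_rigidVelocity (v w c : E3) (j : Fin 3) :
    ContDiff ℝ 1 fun x => rigidVelocity v w c x j := by
  have h0 := contDiff_coord 0 (n := 1)
  have h1 := contDiff_coord 1 (n := 1)
  have h2 := contDiff_coord 2 (n := 1)
  fin_cases j <;> simp [rigidVelocity, cross, crossProduct] <;> fun_prop

/-- The horizontal projection as a continuous linear map. -/
noncomputable def horizL : E3 →L[ℝ] E2 := LinearMap.toContinuousLinearMap
  { toFun := horiz
    map_add' := fun x y => by ext i; fin_cases i <;> rfl
    map_smul' := fun t x => by ext i; fin_cases i <;> rfl }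

theorem horizL_apply (x : E3) : horizL x = horiz x := rfl

theorem hasCompactSupport_of_cylinder {σ lo hi : ℝ} {f : E3 → ℝ}
    (hf : ∀ x, σ ≤ ‖horiz x‖ ∨ x 2 ≤ lo ∨ hi ≤ x 2 → f x = 0) : HasCompactSupport f := by
  obtain ⟨K, hK, hs⟩ := slab_subset_compact (σ := σ) (continuous_const (y := lo) (X := E2))
    (continuous_const (y := hi) (X := E2))
  refine HasCompactSupport.intro hK fun x hx => hf x ?_
  by_contra! hcon
  exact hx (hs ⟨hcon.1, hcon.2.1, hcon.2.2⟩)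

theorem fderiv_eq_zero_of_cylinder {σ lo hi : ℝ} {f : E3 → ℝ} (hfd : Differentiable ℝ f)
    (hf : ∀ x, σ ≤ ‖horiz x‖ ∨ x 2 ≤ lo ∨ hi ≤ x 2 → f x = 0) {x : E3}
    (hx : σ ≤ ‖horiz x‖ ∨ x 2 < lo ∨ hi < x 2) : fderiv ℝ f x (basisVec 2) = 0 := by
  refine fderiv_basisVec_two_eq hfd
    ((hasDerivAt_const (x 2) (0 : ℝ)).congr_of_eventuallyEq ?_)
  rcases hx with h | h | h
  · exact Eventually.of_forall fun t => hf _ (Or.inl (by simpa using h))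
  · filter_upwards [eventually_lt_nhds h] with t ht using hf _ (Or.inr (Or.inl (by simpa using ht.le)))
  · filter_upwards [eventually_gt_nhds h] with t ht using hf _ (Or.inr (Or.inr (by simpa using ht.le)))

theorem IsGap.slab_subset_fluid {k K h r H σ : ℝ} {S Ω : Set E3} {a b : E2 → ℝ}
    (hg : IsGap k K h r H S Ω a b) (hσ : σ ≤ r) :
    slab σ a (fun y => h + b y) ⊆ fluid S Ω := fun x hx => by
  have := hg.mem_fluid _ (hx.1.trans_le hσ) _ hx.2.1 hx.2.2
  rwa [pt_horiz] at this

theorem IsGap.slab_subset_body {k K h r H σ : ℝ} {S Ω : Set E3} {a b : E2 → ℝ}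
    (hg : IsGap k K h r H S Ω a b) (hσ : σ ≤ r) :
    slab σ (fun y => h + b y) (fun _ => h + H) ⊆ S := fun x hx => by
  have := hg.mem_body _ (hx.1.trans_le hσ) _ hx.2.1 hx.2.2
  rwa [pt_horiz] at this

theorem MemLp.integrableOn_mul {U : Set E3} {f φ : E3 → ℝ} (hf : MemLp f 2 (volume.restrict U))
    (hφ : Continuous φ) (hc : HasCompactSupport φ) : IntegrableOn (fun x => f x * φ x) U :=
  MemLp.integrable_mul (q := 2) hf ((hφ.memLp_of_hasCompactSupport hc).restrict U)

theorem hasCompactSupport_fderiv_apply {φ : E3 → ℝ} (hc : HasCompactSupport φ) (v : E3) :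
    HasCompactSupport fun x => fderiv ℝ φ x v :=
  (hc.fderiv ℝ).comp_left (g := fun L : E3 →L[ℝ] ℝ => L v) (by simp)

/-- Vertical integration by parts in the gap for a function which vanishes at the bottom, in the
sense that its extension by zero has a weak derivative, and is equal to `ρ` at the top. -/
theorem IsGap.vertical_by_parts {k K h r H σ : ℝ} {S Ω : Set E3} {a b : E2 → ℝ}
    (hg : IsGap k K h r H S Ω a b) (hH : 0 < H) (hSo : IsOpen S) (hSΩ : S ⊆ Ω) (hσ : σ ≤ r)
    (hΩ : IsOpen Ω) (hbH : ∀ y, ‖y‖ < σ → b y ≤ H)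
    {f f' ρ : E3 → ℝ} (hf : MemLp f 2 (volume.restrict Ω))
    (hf' : MemLp f' 2 (volume.restrict Ω)) (hw : IsWeakPartial Ω 2 f f')
    (hD : ∀ φ : E3 → ℝ, ContDiff ℝ 1 φ → HasCompactSupport φ →
      ∫ x in Ω, f x * fderiv ℝ φ x (basisVec 2) = - ∫ x in Ω, f' x * φ x)
    (hρ : ContDiff ℝ 1 ρ) (hfρ : ∀ᵐ x ∂(volume.restrict S), f x = ρ x)
    {Z : E3 → ℝ} (hZ : ContDiff ℝ 1 Z)
    (hZ0 : ∀ x, σ ≤ ‖horiz x‖ ∨ x 2 ≤ -(H / 2) ∨ h + H / 2 ≤ x 2 → Z x = 0) :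
    (∫ x in slab σ a (fun y => h + b y), f x * fderiv ℝ Z x (basisVec 2)) +
      ∫ x in slab σ a (fun y => h + b y), f' x * Z x =
    ∫ y in Metric.ball (0 : E2) σ, ρ (pt y (h + b y)) * Z (pt y (h + b y)) := by
  have cb : Continuous fun y => h + b y := continuous_const.add hg.contDiff_top.continuous
  have hZd := hZ.differentiable one_ne_zero
  have hρd := hρ.differentiable one_ne_zero
  have hZc := hasCompactSupport_of_cylinder hZ0
  have cZ' : Continuous fun x => fderiv ℝ Z x (basisVec 2) :=
    (hZ.continuous_fderiv one_ne_zero).clm_apply continuous_const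
  have cρ' : Continuous fun x => fderiv ℝ ρ x (basisVec 2) :=
    (hρ.continuous_fderiv one_ne_zero).clm_apply continuous_const
  -- Z already vanishes from depth H/2 on, so at depth H the strict inequalities needed for its
  -- derivative to vanish hold.
  have hlarge : ∀ x : E3, σ ≤ ‖horiz x‖ ∨ x 2 ≤ -H ∨ h + H ≤ x 2 →
      σ ≤ ‖horiz x‖ ∨ x 2 < -(H / 2) ∨ h + H / 2 < x 2 := by
    rintro x (hx | hx | hx)
    · exact Or.inl hx
    · exact Or.inr (Or.inl (by linarith))
    · exact Or.inr (Or.inr (by linarith))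
  have e1 := hg.setIntegral_eq_add hSΩ hσ hΩ
    (MemLp.integrableOn_mul hf cZ' (hasCompactSupport_fderiv_apply hZc _)) fun x hx => by
      rw [fderiv_eq_zero_of_cylinder hZd hZ0 (hlarge x hx), mul_zero]
  have e2 := hg.setIntegral_eq_add hSΩ hσ hΩ
    (MemLp.integrableOn_mul hf' hZ.continuous hZc) fun x hx => by
      rw [hZ0 x ((hlarge x hx).imp_right (Or.imp le_of_lt le_of_lt)), mul_zero]
  have hS : slab σ (fun y => h + b y) (fun _ => h + H) ⊆ S := hg.slab_subset_body hσ
  have hρw : ∀ᵐ x ∂(volume.restrict S), f' x = fderiv ℝ ρ x (basisVec 2) :=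
    ((hw.mono hΩ hSΩ).congr_left hfρ (hρ.continuous.locallyIntegrable.locallyIntegrableOn _)).ae_eq
      hSo (isWeakPartial_of_contDiff 2 hρ)
  have a1 : ∫ x in slab σ (fun y => h + b y) (fun _ => h + H), f x * fderiv ℝ Z x (basisVec 2) =
      ∫ x in slab σ (fun y => h + b y) (fun _ => h + H), ρ x * fderiv ℝ Z x (basisVec 2) :=
    integral_congr_ae ((ae_restrict_of_ae_restrict_of_subset hS hfρ).mono fun x hx => by
      simp only [hx])
  have a2 : ∫ x in slab σ (fun y => h + b y) (fun _ => h + H), f' x * Z x =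
      ∫ x in slab σ (fun y => h + b y) (fun _ => h + H), fderiv ℝ ρ x (basisVec 2) * Z x :=
    integral_congr_ae ((ae_restrict_of_ae_restrict_of_subset hS hρw).mono fun x hx => by
      simp only [hx])
  -- In the body f is the smooth ρ, so the derivative of ρZ integrates to minus its value on the
  -- upper graph. This is the only boundary term; no trace of f is needed.
  have a3 := setIntegral_slab_of_hasDerivAt (σ := σ) cb (continuous_const (y := h + H))
    (fun y hy => by linarith [hbH y hy])
    (F := fun x => ρ x * Z x)
    (F' := fun x => fderiv ℝ ρ x (basisVec 2) * Z x + ρ x * fderiv ℝ Z x (basisVec 2))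
    ((cρ'.mul hZ.continuous).add (hρ.continuous.mul cZ'))
    fun y t => (hasDerivAt_slice hρd y t).mul (hasDerivAt_slice hZd y t)
  have htop : ∀ y, Z (pt y (h + H)) = 0 := fun y =>
    hZ0 _ (Or.inr (Or.inr (by rw [pt_two]; linarith)))
  have i1 : IntegrableOn (fun x => fderiv ℝ ρ x (basisVec 2) * Z x)
      (slab σ (fun y => h + b y) fun _ => h + H) :=
    Continuous.integrableOn_slab cb continuous_const (cρ'.mul hZ.continuous)
  have i2 : IntegrableOn (fun x => ρ x * fderiv ℝ Z x (basisVec 2))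
      (slab σ (fun y => h + b y) fun _ => h + H) :=
    Continuous.integrableOn_slab cb continuous_const (hρ.continuous.mul cZ')
  rw [integral_add i1 i2] at a3
  simp only [htop, mul_zero, zero_sub, integral_neg] at a3
  have e0 := hD Z hZ hZc
  rw [e1, e2, a1, a2] at e0
  linarith

theorem exists_cutoff {h H : ℝ} (hh : 0 ≤ h) (hH : 0 < H) : ∃ χ : ℝ → ℝ, ContDiff ℝ 1 χ ∧
    (∀ t, -(H / 4) ≤ t → t ≤ h + H / 4 → χ t = 1) ∧
    ∀ t, t ≤ -(H / 2) ∨ h + H / 2 ≤ t → χ t = 0 := by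
  let χ : ContDiffBump (h / 2 : ℝ) := ⟨h / 2 + H / 4, h / 2 + H / 2, by positivity, by linarith⟩
  refine ⟨χ, χ.contDiff, fun t h1 h2 => χ.one_of_mem_closedBall ?_, fun t ht => χ.zero_of_le_dist ?_⟩
  · rw [Metric.mem_closedBall, Real.dist_eq, abs_le]
    constructor <;> simp only [χ] <;> linarith
  · rw [Real.dist_eq, le_abs]
    simp only [χ]
    rcases ht with ht | ht
    · right; linarith
    · left; linarith

/-! ### The trapezoidal rule across the gap -/

variable {k K h r H σ : ℝ} {S Ω : Set E3} {a b : E2 → ℝ}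

/-- The mean of `f` over the gap, weighted by a horizontal function, is given by its boundary values
and its second vertical derivative. -/
theorem IsGap.integral_eq_second_derivative
    (hg : IsGap k K h r H S Ω a b) (hh : 0 ≤ h) (hH : 0 < H) (hSo : IsOpen S) (hSΩ : S ⊆ Ω)
    (hσ : σ < r) (hΩ : IsOpen Ω) (haH : ∀ y, ‖y‖ < σ → |a y| ≤ H / 4)
    (hbH : ∀ y, ‖y‖ < σ → |b y| ≤ H / 4)
    {f f' g' f'' ρ : E3 → ℝ} (hf : MemLp f 2 (volume.restrict Ω))
    (hf' : MemLp f' 2 (volume.restrict Ω)) (hw : IsWeakPartial Ω 2 f f')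
    (hD : ∀ φ : E3 → ℝ, ContDiff ℝ 1 φ → HasCompactSupport φ →
      ∫ x in Ω, f x * fderiv ℝ φ x (basisVec 2) = - ∫ x in Ω, f' x * φ x)
    (hρ : ContDiff ℝ 1 ρ) (hfρ : ∀ᵐ x ∂(volume.restrict S), f x = ρ x)
    (hg' : IsWeakPartial (fluid S Ω) 2 f g')
    (hw' : IsWeakPartial (fluid S Ω) 2 g' f'') (hf'' : MemLp f'' 2 (volume.restrict (fluid S Ω)))
    {e : E2 → ℝ} (he : ContDiff ℝ 1 e) (he0 : ∀ y, σ ≤ ‖y‖ → e y = 0) :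
    ∫ x in slab σ a (fun y => h + b y), f x * e (horiz x) =
      1 / 2 * (∫ y in Metric.ball (0 : E2) σ, ρ (pt y (h + b y)) * (e y * (h + b y - a y))) -
      1 / 2 * ∫ x in slab σ a (fun y => h + b y),
        f'' x * (e (horiz x) * ((x 2 - a (horiz x)) * (h + b (horiz x) - x 2))) := by
  obtain ⟨χ, hχ, hχ1, hχ0⟩ := exists_cutoff hh hH
  have c1 : ContDiff ℝ 1 horiz := contDiff_horiz
  have c2 : ContDiff ℝ 1 fun x : E3 => x 2 := contDiff_coord 2
  have hF : IsOpen (fluid S Ω) := hΩ.sdiff isClosed_closure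
  have hFΩ : fluid S Ω ⊆ Ω := sdiff_subset
  have ca := hg.contDiff_bottom.continuous
  have hc1 : ContDiff ℝ 1 fun y => h + b y := contDiff_const.add hg.contDiff_top
  have cb : Continuous fun y => h + b y := hc1.continuous
  set G := slab σ a (fun y => h + b y) with hG
  have hGm : MeasurableSet G := (isOpen_slab ca cb).measurableSet
  have hGF : G ⊆ fluid S Ω := hg.slab_subset_fluid hσ.le
  obtain ⟨Q, hQ, hGQ⟩ := slab_subset_compact (σ := σ) ca cb
  have hQfin : volume G ≠ ⊤ := ((measure_mono hGQ).trans_lt hQ.measure_lt_top).ne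
  have fin1 : ∀ {q : E3 → ℝ} {U : Set E3}, G ⊆ U → MemLp q 2 (volume.restrict U) →
      IntegrableOn q G := by
    intro q U hGU hq
    have : IsFiniteMeasure (volume.restrict G) := ⟨by
      rw [Measure.restrict_apply_univ]; exact hQfin.lt_top⟩
    exact (hq.mono_measure (Measure.restrict_mono hGU le_rfl)).integrable (by norm_num)
  -- The gradient on Ω encodes the no-slip condition, while the one on the fluid region has a
  -- further weak derivative; uniqueness of weak derivatives identifies them in the gap.
  have hgf : ∀ᵐ x ∂(volume.restrict G), g' x = f' x :=
    ae_restrict_of_ae_restrict_of_subset hGF (hg'.ae_eq hF (hw.mono hΩ hFΩ))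
  have hf'G : IntegrableOn f' G := fin1 (hGF.trans hFΩ) hf'
  have hg'G : IntegrableOn g' G := hf'G.congr (hgf.mono fun x hx => hx.symm)
  -- Up to the cutoff, Z is affine in x₃ with slope e, antisymmetric about the middle of the gap.
  -- Its value at the top is e(h + b - a)/2, and it is -1/2 times the vertical derivative of the
  -- quadratic weight.
  let Z : E3 → ℝ := fun x =>
    -(1 / 2) * (e (horiz x) * (a (horiz x) + (h + b (horiz x)) - 2 * x 2)) * χ (x 2)
  have hZ : ContDiff ℝ 1 Z := (contDiff_const.mul ((he.comp c1).mul
    (((hg.contDiff_bottom.comp c1).add (hc1.comp c1)).sub (contDiff_const.mul c2)))).mul (hχ.comp c2)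
  have hZ0 : ∀ x, σ ≤ ‖horiz x‖ ∨ x 2 ≤ -(H / 2) ∨ h + H / 2 ≤ x 2 → Z x = 0 := by
    rintro x (hx | hx)
    · simp [Z, he0 _ hx]
    · simp [Z, hχ0 _ hx]
  have key := hg.vertical_by_parts hH hSo hSΩ hσ.le hΩ
    (fun y hy => by linarith [(abs_le.1 (hbH y hy)).2]) hf hf' hw hD hρ hfρ hZ hZ0
  have g1 : ∫ x in G, f x * fderiv ℝ Z x (basisVec 2) = ∫ x in G, f x * e (horiz x) := by
    refine setIntegral_congr_fun hGm fun x hx => ?_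
    have h1 := (abs_le.1 (haH _ hx.1)).1
    have h2 := (abs_le.1 (hbH _ hx.1)).2
    congr 1
    refine fderiv_basisVec_two_eq (hZ.differentiable one_ne_zero) ?_
    have hd : HasDerivAt (fun t : ℝ => -(1 / 2) * (e (horiz x) *
        (a (horiz x) + (h + b (horiz x)) - 2 * t))) (e (horiz x)) (x 2) :=
      (((((hasDerivAt_id (x 2)).const_mul 2).const_sub _).const_mul (e (horiz x))).const_mul
        (-(1 / 2))).congr_deriv (by ring)
    refine hd.congr_of_eventuallyEq ?_
    have hx1 : -(H / 4) < x 2 := h1.trans_lt hx.2.1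
    have hx2 : x 2 < h + H / 4 := hx.2.2.trans_le (by linarith)
    filter_upwards [Ioo_mem_nhds hx1 hx2] with t ht
    simp [Z, hχ1 t ht.1.le ht.2.le]
  have g2 : ∫ x in G, f' x * Z x = -(1 / 2) * ∫ x in G,
      g' x * (e (horiz x) * (a (horiz x) + (h + b (horiz x)) - 2 * x 2)) := by
    rw [← integral_const_mul]
    refine integral_congr_ae ?_
    filter_upwards [hgf, ae_restrict_mem hGm] with x hx hxG
    have h1 := (abs_le.1 (haH _ hxG.1)).1
    have h2 := (abs_le.1 (hbH _ hxG.1)).2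
    simp only [Z]
    rw [hx, hχ1 _ (by linarith [hxG.2.1]) (by linarith [hxG.2.2])]
    ring
  have g3 := hw'.integral_slab hF hg.contDiff_bottom hc1 he he0
    (fun y hy => hg.bottom_le_top y (hy.trans_lt hσ))
    (fun y hy => hg.mem_fluid y (hy.trans_lt hσ)) hg'G (fin1 hGF hf'')
  have g4 : ∫ y in Metric.ball (0 : E2) σ, ρ (pt y (h + b y)) * Z (pt y (h + b y)) =
      1 / 2 * ∫ y in Metric.ball (0 : E2) σ, ρ (pt y (h + b y)) * (e y * (h + b y - a y)) := by
    rw [← integral_const_mul]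
    refine setIntegral_congr_fun Metric.isOpen_ball.measurableSet fun y hy => ?_
    have hy' : ‖y‖ < σ := by simpa using hy
    have h2 := abs_le.1 (hbH _ hy')
    simp only [Z, horiz_pt, pt_two]
    rw [hχ1 _ (by linarith [h2.1]) (by linarith [h2.2])]
    ring
  rw [g1, g2, g3, g4] at key
  linarith

/-! ### The flux balance -/

theorem fderiv_profile_mul {χ : ℝ → ℝ} (hχ : ContDiff ℝ 1 χ) (σ : ℝ) (x v : E3) :
    fderiv ℝ (fun x : E3 => profile σ (horiz x) * χ (x 2)) x v =
      profile σ (horiz x) * (deriv χ (x 2) * v 2) +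
        χ (x 2) * (slope σ (horiz x) * (x 0 * v 0 + x 1 * v 1)) := by
  have h1 : HasFDerivAt (fun x : E3 => profile σ (horiz x))
      ((slope σ (horiz x) • innerSL ℝ (horiz x)).comp horizL) x :=
    (hasFDerivAt_profile σ (horizL x)).comp x horizL.hasFDerivAt
  have h2 : HasFDerivAt (fun x : E3 => χ (x 2))
      (deriv χ (x 2) • (EuclideanSpace.proj (𝕜 := ℝ) 2 : E3 →L[ℝ] ℝ)) x :=
    ((hχ.differentiable one_ne_zero (x 2)).hasDerivAt).comp_hasFDerivAt x
      (EuclideanSpace.proj (𝕜 := ℝ) 2 : E3 →L[ℝ] ℝ).hasFDerivAt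
  have h3 : HasFDerivAt (fun x : E3 => profile σ (horiz x) * χ (x 2)) _ x := h1.mul h2
  rw [h3.fderiv]
  simp [horizL_apply, PiLp.inner_apply, Fin.sum_univ_two, -mul_eq_mul_left_iff]
  ring

/-- The flux of a divergence free field, which vanishes below the gap and is a rigid motion above,
out of the gap. -/
theorem IsGap.integral_horizontal_flux
    (hg : IsGap k K h r H S Ω a b) (hh : 0 ≤ h) (hH : 0 < H) (hSΩ : S ⊆ Ω)
    (hσ0 : 0 < σ) (hσ : σ < r) (hΩ : IsOpen Ω) (haH : ∀ y, ‖y‖ < σ → |a y| ≤ H / 4)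
    (hbH : ∀ y, ‖y‖ < σ → |b y| ≤ H / 4) {u : E3 → E3} {v w c : E3}
    (hu : ∀ i, MemLp (fun x => u x i) 2 (volume.restrict Ω))
    (hdiv : ∀ φ : E3 → ℝ, ContDiff ℝ 1 φ → HasCompactSupport φ →
      ∑ i, ∫ x in Ω, u x i * fderiv ℝ φ x (basisVec i) = 0)
    (huS : ∀ᵐ x ∂(volume.restrict S), u x = rigidVelocity v w c x) {uP : E3}
    (huP : uP = rigidVelocity v w c (pt 0 h)) :
    (∫ x in slab σ a (fun y => h + b y), u x 0 * (slope σ (horiz x) * (horiz x) 0)) +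
      ∫ x in slab σ a (fun y => h + b y), u x 1 * (slope σ (horiz x) * (horiz x) 1) =
    ∫ y in Metric.ball (0 : E2) σ, (uP 2 * profile σ y +
      slope σ y * (uP 0 * y 0 + uP 1 * y 1) * b y +
      slope σ y * (w 1 * y 0 - w 0 * y 1) * (b y ^ 2 / 2)) := by
  obtain ⟨χ, hχ, hχ1, hχ0⟩ := exists_cutoff hh hH
  have c1 : ContDiff ℝ 1 horiz := contDiff_horiz
  have c2 : ContDiff ℝ 1 fun x : E3 => x 2 := contDiff_coord 2
  have cχ' : Continuous (deriv χ) := hχ.continuous_deriv le_rfl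
  have ca := hg.contDiff_bottom.continuous
  have cb : Continuous fun y => h + b y := continuous_const.add hg.contDiff_top.continuous
  set G := slab σ a (fun y => h + b y) with hG
  have hGm : MeasurableSet G := (isOpen_slab ca cb).measurableSet
  set A := slab σ (fun y => h + b y) (fun _ => h + H) with hA
  have hAS : A ⊆ S := hg.slab_subset_body hσ.le
  let φ : E3 → ℝ := fun x => profile σ (horiz x) * χ (x 2)
  have hφ : ContDiff ℝ 1 φ := ((contDiff_profile σ).comp c1).mul (hχ.comp c2)
  have hχ'0 : ∀ t, t ≤ -H ∨ h + H ≤ t → deriv χ t = 0 := by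
    intro t ht
    refine ((hasDerivAt_const t (0 : ℝ)).congr_of_eventuallyEq ?_).deriv
    rcases ht with ht | ht
    · filter_upwards [eventually_lt_nhds (show t < -(H / 2) by linarith)] with s hs
        using hχ0 s (Or.inl hs.le)
    · filter_upwards [eventually_gt_nhds (show h + H / 2 < t by linarith)] with s hs
        using hχ0 s (Or.inr hs.le)
  have hφc : HasCompactSupport φ := hasCompactSupport_of_cylinder (σ := σ) (lo := -(H / 2))
    (hi := h + H / 2) fun x hx => by
      rcases hx with hx | hx
      · simp [φ, profile_eq_zero hσ0 hx]
      · simp [φ, hχ0 _ hx]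
  have d0 : ∀ x, fderiv ℝ φ x (basisVec 0) = χ (x 2) * (slope σ (horiz x) * x 0) := fun x => by
    rw [fderiv_profile_mul hχ]; simp [basisVec]
  have d1 : ∀ x, fderiv ℝ φ x (basisVec 1) = χ (x 2) * (slope σ (horiz x) * x 1) := fun x => by
    rw [fderiv_profile_mul hχ]; simp [basisVec]
  have d2 : ∀ x, fderiv ℝ φ x (basisVec 2) = profile σ (horiz x) * deriv χ (x 2) := fun x => by
    rw [fderiv_profile_mul hχ]; simp [basisVec]
  have hvan : ∀ i, ∀ x : E3, σ ≤ ‖horiz x‖ ∨ x 2 ≤ -H ∨ h + H ≤ x 2 →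
      u x i * fderiv ℝ φ x (basisVec i) = 0 := by
    intro i x hx
    have h3 : σ ≤ ‖horiz x‖ ∨ (χ (x 2) = 0 ∧ deriv χ (x 2) = 0) := by
      refine hx.imp_right fun hx => ⟨hχ0 _ (hx.imp (fun h => by linarith) fun h => by linarith),
        hχ'0 _ hx⟩
    rw [fderiv_profile_mul hχ]
    rcases h3 with h3 | ⟨h3, h4⟩
    · rw [profile_eq_zero hσ0 h3, slope_eq_zero hσ0 h3]; simp
    · rw [h3, h4]; simp
  have cφ' : ∀ i, Continuous fun x => fderiv ℝ φ x (basisVec i) := fun i =>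
    (hφ.continuous_fderiv one_ne_zero).clm_apply continuous_const
  have split := fun i => hg.setIntegral_eq_add hSΩ hσ.le hΩ
    (MemLp.integrableOn_mul (hu i) (cφ' i) (hasCompactSupport_fderiv_apply hφc _)) (hvan i)
  have h0 := hdiv φ hφ hφc
  rw [Fin.sum_univ_three, split, split, split] at h0
  have body : ∀ i, ∫ x in A, u x i * fderiv ℝ φ x (basisVec i) =
      ∫ x in A, rigidVelocity v w c x i * fderiv ℝ φ x (basisVec i) := fun i =>
    integral_congr_ae ((ae_restrict_of_ae_restrict_of_subset hAS huS).mono fun x hx => by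
      simp only [hx])
  have gapx : ∀ x ∈ G, -(H / 4) < x 2 ∧ x 2 < h + H / 4 := fun x hx =>
    ⟨by linarith [hx.2.1, (abs_le.1 (haH _ hx.1)).1],
      by linarith [hx.2.2, (abs_le.1 (hbH _ hx.1)).2]⟩
  have gap0 : ∫ x in G, u x 0 * fderiv ℝ φ x (basisVec 0) =
      ∫ x in G, u x 0 * (slope σ (horiz x) * (horiz x) 0) :=
    setIntegral_congr_fun hGm fun x hx => by
      simp only [d0, hχ1 _ (gapx x hx).1.le (gapx x hx).2.le, one_mul, horiz_zero]
  have gap1 : ∫ x in G, u x 1 * fderiv ℝ φ x (basisVec 1) =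
      ∫ x in G, u x 1 * (slope σ (horiz x) * (horiz x) 1) :=
    setIntegral_congr_fun hGm fun x hx => by
      simp only [d1, hχ1 _ (gapx x hx).1.le (gapx x hx).2.le, one_mul, horiz_one]
  have gap2 : ∫ x in G, u x 2 * fderiv ℝ φ x (basisVec 2) = 0 := by
    refine setIntegral_eq_zero_of_forall_eq_zero fun x hx => ?_
    have : deriv χ (x 2) = 0 := by
      refine ((hasDerivAt_const (x 2) (1 : ℝ)).congr_of_eventuallyEq ?_).deriv
      filter_upwards [Ioo_mem_nhds (gapx x hx).1 (gapx x hx).2] with t ht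
        using hχ1 t ht.1.le ht.2.le
    rw [d2, this, mul_zero, mul_zero]
  have iA : ∀ i, IntegrableOn (fun x => rigidVelocity v w c x i * fderiv ℝ φ x (basisVec i)) A :=
    fun i => Continuous.integrableOn_slab cb continuous_const
      ((contDiff_rigidVelocity v w c i).continuous.mul (cφ' i))
  have cs1 : Continuous fun s => (s - h) * χ s := (by fun_prop : Continuous fun s : ℝ => s - h).mul
    hχ.continuous
  let X0 : ℝ → ℝ := fun t => ∫ s in h..t, χ s
  let X1 : ℝ → ℝ := fun t => ∫ s in h..t, (s - h) * χ s
  have hX0 : ∀ t, HasDerivAt X0 (χ t) t := fun t =>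
    (hχ.continuous.integral_hasStrictDerivAt h t).hasDerivAt
  have hX1 : ∀ t, HasDerivAt X1 ((t - h) * χ t) t := fun t =>
    (cs1.integral_hasStrictDerivAt h t).hasDerivAt
  have interval_mem : ∀ y : E2, ‖y‖ < σ → ∀ s ∈ uIcc h (h + b y), χ s = 1 := by
    intro y hy s hs
    have := abs_le.1 (hbH y hy)
    rcases mem_uIcc.1 hs with hs | hs
    · exact hχ1 s (by linarith [hs.1]) (by linarith [hs.2])
    · exact hχ1 s (by linarith [hs.1]) (by linarith [hs.2])
  have hX0b : ∀ y : E2, ‖y‖ < σ → X0 (h + b y) = b y := by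
    intro y hy
    simp only [X0]
    rw [intervalIntegral.integral_congr (g := fun _ => (1 : ℝ)) (interval_mem y hy)]
    simp
  have hX1b : ∀ y : E2, ‖y‖ < σ → X1 (h + b y) = b y ^ 2 / 2 := by
    intro y hy
    simp only [X1]
    rw [intervalIntegral.integral_congr (g := fun s => s - h) fun s hs => by
      simp only [interval_mem y hy s hs, mul_one]]
    rw [intervalIntegral.integral_comp_sub_right (fun s => s) h]
    simp
  -- A vertical primitive of the rigid velocity paired with the gradient of φ, normalized to vanish
  -- at height h + H. `X0` and `X1` start at h, so on the upper graph they reduce to b and b²/2.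
  let F : E3 → ℝ := fun x =>
    slope σ (horiz x) * (uP 0 * x 0 + uP 1 * x 1) * (X0 (x 2) - X0 (h + H)) +
    slope σ (horiz x) * (w 1 * x 0 - w 0 * x 1) * (X1 (x 2) - X1 (h + H)) +
    (uP 2 + (w 0 * x 1 - w 1 * x 0)) * profile σ (horiz x) * χ (x 2)
  let F' : E3 → ℝ := fun x =>
    slope σ (horiz x) * (uP 0 * x 0 + uP 1 * x 1) * χ (x 2) +
    slope σ (horiz x) * (w 1 * x 0 - w 0 * x 1) * ((x 2 - h) * χ (x 2)) +
    (uP 2 + (w 0 * x 1 - w 1 * x 0)) * profile σ (horiz x) * deriv χ (x 2)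
  have cslope : Continuous fun x : E3 => slope σ (horiz x) :=
    (contDiff_slope σ).continuous.comp c1.continuous
  have cprof : Continuous fun x : E3 => profile σ (horiz x) :=
    (contDiff_profile σ).continuous.comp c1.continuous
  have cχ2 : Continuous fun x : E3 => χ (x 2) := hχ.continuous.comp c2.continuous
  have cχ2' : Continuous fun x : E3 => deriv χ (x 2) := cχ'.comp c2.continuous
  have hF'c : Continuous F' := by
    simp only [F']
    fun_prop
  have hFd : ∀ y t, HasDerivAt (fun t => F (pt y t)) (F' (pt y t)) t := by
    intro y t
    simp only [F, F', horiz_pt, pt_zero, pt_one, pt_two]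
    exact ((((hX0 t).sub_const _).const_mul _).add (((hX1 t).sub_const _).const_mul _)).add
      (((hχ.differentiable one_ne_zero t).hasDerivAt).const_mul _)
  have hF'eq : ∀ x, rigidVelocity v w c x 0 * fderiv ℝ φ x (basisVec 0) +
      rigidVelocity v w c x 1 * fderiv ℝ φ x (basisVec 1) +
      rigidVelocity v w c x 2 * fderiv ℝ φ x (basisVec 2) = F' x := by
    intro x
    obtain ⟨e0, e1, e2⟩ := rigidVelocity_components v w c x h
    rw [e0, e1, e2, d0, d1, d2, ← huP]
    simp only [F']
    ring
  have above : (∫ x in A, rigidVelocity v w c x 0 * fderiv ℝ φ x (basisVec 0)) +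
      (∫ x in A, rigidVelocity v w c x 1 * fderiv ℝ φ x (basisVec 1)) +
      ∫ x in A, rigidVelocity v w c x 2 * fderiv ℝ φ x (basisVec 2) =
      ∫ y in Metric.ball (0 : E2) σ, -F (pt y (h + b y)) := by
    have i01 : IntegrableOn (fun x => rigidVelocity v w c x 0 * fderiv ℝ φ x (basisVec 0) +
      rigidVelocity v w c x 1 * fderiv ℝ φ x (basisVec 1)) A := (iA 0).add (iA 1)
    rw [← integral_add (iA 0) (iA 1), ← integral_add i01 (iA 2)]
    simp_rw [hF'eq]
    rw [setIntegral_slab_of_hasDerivAt cb continuous_const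
      (fun y hy => by linarith [(abs_le.1 (hbH y hy)).2]) hF'c hFd]
    congr 1 with y
    have hz : χ (h + H) = 0 := hχ0 _ (Or.inr (by linarith))
    have : F (pt y (h + H)) = 0 := by simp [F, hz]
    rw [this, zero_sub]
  have cs : Continuous (slope σ) := (contDiff_slope σ).continuous
  have cp : Continuous (profile σ) := (contDiff_profile σ).continuous
  have cbb : Continuous b := hg.contDiff_top.continuous
  have ball_int : ∀ {q : E2 → ℝ}, Continuous q → IntegrableOn q (Metric.ball 0 σ) := fun hq =>
    (hq.continuousOn.integrableOn_compact (isCompact_closedBall (0 : E2) σ)).mono_set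
      Metric.ball_subset_closedBall
  have top : ∫ y in Metric.ball (0 : E2) σ, -F (pt y (h + b y)) =
      -∫ y in Metric.ball (0 : E2) σ, (uP 2 * profile σ y +
        slope σ y * (uP 0 * y 0 + uP 1 * y 1) * b y +
        slope σ y * (w 1 * y 0 - w 0 * y 1) * (b y ^ 2 / 2)) := by
    -- The contributions depending on how χ decays inside the body, and the tilt of the normal
    -- velocity against the profile, are odd in y and integrate to zero.
    have hodd : ∫ y in Metric.ball (0 : E2) σ,
        ((w 0 * y 1 - w 1 * y 0) * profile σ y
          - slope σ y * (uP 0 * y 0 + uP 1 * y 1) * X0 (h + H)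
          - slope σ y * (w 1 * y 0 - w 0 * y 1) * X1 (h + H)) = 0 :=
      setIntegral_ball_eq_zero_of_odd fun y => by
        simp only [profile_neg, slope_neg, PiLp.neg_apply]; ring
    rw [integral_neg, neg_inj, ← add_zero (∫ y in Metric.ball (0 : E2) σ, (uP 2 * profile σ y + _ + _)),
      ← hodd, ← integral_add (ball_int (by fun_prop)) (ball_int (by fun_prop))]
    refine setIntegral_congr_fun Metric.isOpen_ball.measurableSet fun y hy => ?_
    have hy' : ‖y‖ < σ := by simpa using hy
    have hb1 := abs_le.1 (hbH _ hy')
    simp only [F, horiz_pt, pt_zero, pt_one, pt_two, hX0b y hy', hX1b y hy']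
    rw [hχ1 _ (by linarith [hb1.1]) (by linarith [hb1.2])]
    ring
  rw [body, body, body, gap0, gap1, gap2] at h0
  linarith

/-! ### Bounds for the flux terms and the normal velocity -/

theorem setIntegral_le_sqrt_mul_sqrt {G : Set E3} (hG : volume G ≠ ⊤) {q : E3 → ℝ}
    (hq0 : ∀ x, 0 ≤ q x) (hq : MemLp q 2 (volume.restrict G)) :
    ∫ x in G, q x ≤ √(∫ x in G, q x ^ 2) * √(volume.real G) := by
  have : IsFiniteMeasure (volume.restrict G) := ⟨by
    rw [Measure.restrict_apply_univ]; exact hG.lt_top⟩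
  have h2 : ENNReal.ofReal 2 = 2 := by simp
  have := integral_mul_le_Lp_mul_Lq_of_nonneg (μ := volume.restrict G) (f := q) (g := fun _ => 1)
    Real.HolderConjugate.two_two (Eventually.of_forall hq0) (Eventually.of_forall fun _ => zero_le_one)
    (by rwa [h2]) (memLp_const 1)
  simpa [Real.sqrt_eq_rpow] using this

theorem abs_add_mul_le (p q s t : ℝ) : |p * s + q * t| ≤ √(p ^ 2 + q ^ 2) * √(s ^ 2 + t ^ 2) := by
  rw [← Real.sqrt_mul (by positivity)]
  refine Real.abs_le_sqrt ?_
  nlinarith [sq_nonneg (p * t - q * s)]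

theorem norm_eq_sqrt (y : E2) : ‖y‖ = √(y 0 ^ 2 + y 1 ^ 2) := by
  simp [EuclideanSpace.norm_eq, Fin.sum_univ_two]

theorem abs_slope_mul_le (hσ : 0 < σ) (p q : ℝ) (y : E2) :
    |slope σ y * (p * y 0 + q * y 1)| ≤ 8 * Real.exp (-2) / σ * √(p ^ 2 + q ^ 2) := by
  have h1 := abs_add_mul_le p q (y 0) (y 1)
  rw [← norm_eq_sqrt] at h1
  rw [abs_mul]
  calc |slope σ y| * |p * y 0 + q * y 1| ≤ |slope σ y| * (√(p ^ 2 + q ^ 2) * ‖y‖) := by gcongr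
    _ = (|slope σ y| * ‖y‖) * √(p ^ 2 + q ^ 2) := by ring
    _ ≤ _ := by gcongr; exact abs_slope_mul_norm_le hσ y

theorem volume_real_ball (hσ : 0 ≤ σ) : volume.real (Metric.ball (0 : E2) σ) = Real.pi * σ ^ 2 := by
  rw [measureReal_def, EuclideanSpace.volume_ball_fin_two, ENNReal.toReal_mul, ENNReal.toReal_pow,
    ENNReal.toReal_ofReal hσ, ENNReal.toReal_ofReal Real.pi_pos.le, mul_comm]

theorem abs_setIntegral_ball_le (hσ : 0 ≤ σ) {f : E2 → ℝ} {C : ℝ} (hf : ∀ y, ‖y‖ < σ → |f y| ≤ C) :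
    |∫ y in Metric.ball (0 : E2) σ, f y| ≤ C * (Real.pi * σ ^ 2) := by
  have := norm_setIntegral_le_of_norm_le_const (μ := volume) (s := Metric.ball (0 : E2) σ) (f := f)
    (C := C) (by rw [EuclideanSpace.volume_ball_fin_two]; finiteness) fun y hy =>
      hf y (by simpa using hy)
  rwa [volume_real_ball hσ] at this

theorem IsGap.abs_le_of_lt (hg : IsGap k K h r H S Ω a b) (hk : 0 ≤ k) (hσ : σ ≤ r) {y : E2}
    (hy : ‖y‖ < σ) : |a y| ≤ k * σ ^ 2 ∧ |b y| ≤ k * σ ^ 2 :=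
  ⟨(hg.abs_bottom_le y (hy.trans_le hσ)).trans (by gcongr),
    (hg.abs_top_le y (hy.trans_le hσ)).trans (by gcongr)⟩

theorem IsGap.volume_real_le (hg : IsGap k K h r H S Ω a b) (hk : 0 ≤ k) (hσ0 : 0 ≤ σ) (hσ : σ ≤ r) :
    volume.real (slab σ a (fun y => h + b y)) ≤ (h + 2 * k * σ ^ 2) * (Real.pi * σ ^ 2) := by
  have ca := hg.contDiff_bottom.continuous
  have cb : Continuous fun y => h + b y := continuous_const.add hg.contDiff_top.continuous
  have h1 := setIntegral_slab (σ := σ) ca cb (fun y hy => hg.bottom_le_top y (hy.trans_le hσ))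
    (f := fun _ => 1) (Continuous.integrableOn_slab ca cb continuous_const)
  simp only [setIntegral_const, smul_eq_mul, mul_one, intervalIntegral.integral_const] at h1
  rw [h1]
  refine (le_abs_self _).trans (abs_setIntegral_ball_le hσ0 fun y hy => ?_)
  have h2 := hg.abs_le_of_lt hk hσ hy
  rw [abs_of_nonneg (by linarith [hg.bottom_le_top y (hy.trans_le hσ)])]
  linarith [(abs_le.1 h2.1).1, (abs_le.1 h2.2).2]

theorem IsGap.slab_subset_cyl (hg : IsGap k K h r H S Ω a b) (hk : 0 < k) (hσ0 : 0 < σ)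
    (hσ : σ ≤ r) : slab σ a (fun y => h + b y) ⊆ cyl k h σ ∩ fluid S Ω := fun x hx => by
  have h2 := hg.abs_le_of_lt hk.le hσ hx.1
  have h3 : 0 < k * σ ^ 2 := by positivity
  exact ⟨⟨hx.1, by linarith [(abs_le.1 h2.1).1, hx.2.1],
    by linarith [(abs_le.1 h2.2).2, hx.2.2]⟩, hg.slab_subset_fluid hσ hx⟩

/-- The contribution of the second derivatives of `u` to the flux. -/
theorem IsGap.abs_integral_second_derivative_le (hg : IsGap k K h r H S Ω a b) (hk : 0 < k)
    (hkK : k ≤ K) (hh : 0 ≤ h) (hσ0 : 0 < σ) (hσ : σ ≤ r)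
    {D2u : E3 → Fin 3 → Fin 3 → Fin 3 → ℝ}
    (hD2 : ∀ i j l, MemLp (fun x => D2u x i j l) 2 (volume.restrict (fluid S Ω))) :
    |(∫ x in slab σ a (fun y => h + b y), D2u x 2 2 0 *
          (slope σ (horiz x) * (horiz x) 0 * ((x 2 - a (horiz x)) * (h + b (horiz x) - x 2)))) +
      ∫ x in slab σ a (fun y => h + b y), D2u x 2 2 1 *
          (slope σ (horiz x) * (horiz x) 1 * ((x 2 - a (horiz x)) * (h + b (horiz x) - x 2)))| ≤
    2 * Real.exp (-2) / σ * (h + 2 * K * σ ^ 2) ^ 2 *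
      (hessianL2 (cyl k h σ ∩ fluid S Ω) D2u * √((h + 2 * K * σ ^ 2) * (Real.pi * σ ^ 2))) := by
  set D := h + 2 * K * σ ^ 2 with hD
  have hK : 0 < K := hk.trans_le hkK
  have hD0 : 0 < D := by positivity
  have hkD : h + 2 * k * σ ^ 2 ≤ D := by rw [hD]; gcongr
  have ca := hg.contDiff_bottom.continuous
  have cbb := hg.contDiff_top.continuous
  have cb : Continuous fun y => h + b y := continuous_const.add cbb
  have c1 : Continuous horiz := (contDiff_horiz (n := 0)).continuous
  set G := slab σ a (fun y => h + b y) with hG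
  have hGm : MeasurableSet G := (isOpen_slab ca cb).measurableSet
  have hGF : G ⊆ fluid S Ω := hg.slab_subset_fluid hσ
  obtain ⟨Q, hQ, hGQ⟩ := slab_subset_compact (σ := σ) ca cb
  have hGfin : volume G ≠ ⊤ := ((measure_mono hGQ).trans_lt hQ.measure_lt_top).ne
  have : IsFiniteMeasure (volume.restrict G) := ⟨by
    rw [Measure.restrict_apply_univ]; exact hGfin.lt_top⟩
  have hD2G : ∀ i j l, MemLp (fun x => D2u x i j l) 2 (volume.restrict G) := fun i j l =>
    (hD2 i j l).mono_measure (Measure.restrict_mono hGF le_rfl)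
  let q : E3 → ℝ := fun x => √(D2u x 2 2 0 ^ 2 + D2u x 2 2 1 ^ 2)
  have hq2 : ∀ x, q x ^ 2 = D2u x 2 2 0 ^ 2 + D2u x 2 2 1 ^ 2 := fun x =>
    Real.sq_sqrt (by positivity)
  have hq : MemLp q 2 (volume.restrict G) := by
    have hm : AEStronglyMeasurable q (volume.restrict G) :=
      Real.continuous_sqrt.comp_aestronglyMeasurable
        (((hD2G 2 2 0).aestronglyMeasurable.pow 2).add ((hD2G 2 2 1).aestronglyMeasurable.pow 2))
    rw [memLp_two_iff_integrable_sq hm]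
    simp_rw [hq2]
    exact (hD2G 2 2 0).integrable_sq.add (hD2G 2 2 1).integrable_sq
  have cslope : Continuous fun x : E3 => slope σ (horiz x) :=
    (contDiff_slope σ).continuous.comp c1
  have cw : ∀ l : Fin 2, Continuous fun x : E3 =>
      slope σ (horiz x) * (horiz x) l * ((x 2 - a (horiz x)) * (h + b (horiz x) - x 2)) := by
    intro l
    have e1 : Continuous fun x : E3 => a (horiz x) := ca.comp c1
    have e2 : Continuous fun x : E3 => b (horiz x) := cbb.comp c1
    have e3 : Continuous fun x : E3 => (horiz x) l := by fun_prop
    fun_prop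
  have hint : ∀ (i : Fin 3) (l : Fin 2), IntegrableOn (fun x => D2u x 2 2 i *
      (slope σ (horiz x) * (horiz x) l * ((x 2 - a (horiz x)) * (h + b (horiz x) - x 2)))) G := by
    intro i l
    obtain ⟨C, hC⟩ := hQ.exists_bound_of_continuousOn (cw l).continuousOn
    exact ((hD2G 2 2 i).integrable (by norm_num)).mul_bdd (cw l).aestronglyMeasurable
      ((ae_restrict_iff' hGm).2 (Eventually.of_forall fun x hx => hC x (hGQ hx)))
  rw [← integral_add (hint 0 0) (hint 1 1)]
  have hbound : ∀ x ∈ G, ‖D2u x 2 2 0 *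
        (slope σ (horiz x) * (horiz x) 0 * ((x 2 - a (horiz x)) * (h + b (horiz x) - x 2))) +
      D2u x 2 2 1 *
        (slope σ (horiz x) * (horiz x) 1 * ((x 2 - a (horiz x)) * (h + b (horiz x) - x 2)))‖ ≤
      2 * Real.exp (-2) / σ * D ^ 2 * q x := by
    intro x hx
    have h1 := abs_slope_mul_le hσ0 (D2u x 2 2 0) (D2u x 2 2 1) (horiz x)
    have h2 := hg.abs_le_of_lt hk.le hσ hx.1
    have h3 : 0 ≤ (x 2 - a (horiz x)) * (h + b (horiz x) - x 2) :=
      mul_nonneg (sub_nonneg.2 hx.2.1.le) (sub_nonneg.2 hx.2.2.le)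
    -- The two factors are nonnegative with sum the gap height, which is at most D, so their product
    -- is at most D²/4.
    have h4 : (x 2 - a (horiz x)) * (h + b (horiz x) - x 2) ≤ D ^ 2 / 4 := by
      have h5 : 0 ≤ h + b (horiz x) - a (horiz x) := by
        linarith [hg.bottom_le_top _ (hx.1.trans_le hσ)]
      have h6 : h + b (horiz x) - a (horiz x) ≤ D := by
        linarith [(abs_le.1 h2.1).1, (abs_le.1 h2.2).2]
      have h7 : (h + b (horiz x) - a (horiz x)) ^ 2 ≤ D ^ 2 := by gcongr
      nlinarith [sq_nonneg ((x 2 - a (horiz x)) - (h + b (horiz x) - x 2))]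
    calc _ = |slope σ (horiz x) * (D2u x 2 2 0 * (horiz x) 0 + D2u x 2 2 1 * (horiz x) 1)| *
          ((x 2 - a (horiz x)) * (h + b (horiz x) - x 2)) := by
          rw [Real.norm_eq_abs, ← abs_of_nonneg h3, ← abs_mul, abs_of_nonneg h3]
          congr 1; ring
      _ ≤ (8 * Real.exp (-2) / σ * q x) * (D ^ 2 / 4) := by
          gcongr
      _ = _ := by ring
  refine (norm_integral_le_of_norm_le ((hq.integrable (by norm_num)).const_mul _)
    ((ae_restrict_iff' hGm).2 (Eventually.of_forall hbound))).trans ?_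
  rw [integral_const_mul]
  refine mul_le_mul_of_nonneg_left ?_ (by positivity)
  refine (setIntegral_le_sqrt_mul_sqrt hGfin (fun x => Real.sqrt_nonneg _) hq).trans ?_
  have hsum_int : IntegrableOn (fun x => ∑ i, ∑ j, ∑ l, (D2u x i j l) ^ 2) (fluid S Ω) :=
    integrable_finsetSum _ fun i _ => integrable_finsetSum _ fun j _ => integrable_finsetSum _
      fun l _ => (hD2 i j l).integrable_sq
  refine mul_le_mul (Real.sqrt_le_sqrt ?_) (Real.sqrt_le_sqrt ?_) (Real.sqrt_nonneg _)
    (Real.sqrt_nonneg _)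
  · calc ∫ x in G, q x ^ 2 ≤ ∫ x in G, ∑ i, ∑ j, ∑ l, (D2u x i j l) ^ 2 := by
          refine setIntegral_mono hq.integrable_sq (hsum_int.mono_set hGF) fun x => ?_
          have h1 := Finset.single_le_sum (f := fun i => ∑ j, ∑ l, (D2u x i j l) ^ 2)
            (fun i _ => by positivity) (Finset.mem_univ 2)
          have h2 := Finset.single_le_sum (f := fun j => ∑ l, (D2u x 2 j l) ^ 2)
            (fun i _ => by positivity) (Finset.mem_univ 2)
          refine le_trans ?_ (h2.trans h1)
          simp only [hq2, Fin.sum_univ_three]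
          exact le_add_of_nonneg_right (sq_nonneg _)
      _ ≤ _ := setIntegral_mono_set (hsum_int.mono_set inter_subset_right)
          (Eventually.of_forall fun x => Finset.sum_nonneg fun i _ => Finset.sum_nonneg fun j _ =>
            Finset.sum_nonneg fun l _ => sq_nonneg _)
          (hg.slab_subset_cyl hk hσ0 hσ).eventuallyLE
  · exact (hg.volume_real_le hk.le hσ0.le hσ).trans (by gcongr)

/-- The normal velocity at the closest point, weighted by the profile, is the sum of the flux due to
the second derivatives of `u` and of the flux due to the tangential motion of the body. -/
theorem IsGap.normal_velocity_identity
    (hg : IsGap k K h r H S Ω a b) (hh : 0 ≤ h) (hH : 0 < H) (hSo : IsOpen S) (hSΩ : S ⊆ Ω)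
    (hσ0 : 0 < σ) (hσ : σ < r) (hΩ : IsOpen Ω) (haH : ∀ y, ‖y‖ < σ → |a y| ≤ H / 4)
    (hbH : ∀ y, ‖y‖ < σ → |b y| ≤ H / 4) {u : E3 → E3} {v w c uP : E3}
    {D2u : E3 → Fin 3 → Fin 3 → Fin 3 → ℝ} (hu : MemW120Rigid S Ω u v w c)
    (hdiv : IsDivFree Ω u) (hD2 : HasW22Hessian (fluid S Ω) u D2u)
    (huP : uP = rigidVelocity v w c (pt 0 h)) :
    uP 2 * (∫ y in Metric.ball (0 : E2) σ, profile σ y) =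
      -(1 / 2) * ((∫ x in slab σ a (fun y => h + b y), D2u x 2 2 0 *
          (slope σ (horiz x) * (horiz x) 0 * ((x 2 - a (horiz x)) * (h + b (horiz x) - x 2)))) +
        ∫ x in slab σ a (fun y => h + b y), D2u x 2 2 1 *
          (slope σ (horiz x) * (horiz x) 1 * ((x 2 - a (horiz x)) * (h + b (horiz x) - x 2)))) -
      1 / 4 * (∫ y in Metric.ball (0 : E2) σ, slope σ y * (uP 0 * y 0 + uP 1 * y 1) *
        ((a y - a (-y)) + (b y - b (-y)))) +
      1 / 2 * ∫ y in Metric.ball (0 : E2) σ, slope σ y * (w 1 * y 0 + -w 0 * y 1) *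
        (b y * (h - a y)) := by
  obtain ⟨⟨hu0, huS⟩, Du', hDu', hD2'⟩ := (⟨hu, hD2⟩ : _ ∧ _)
  obtain ⟨Du, hDu, hD⟩ := hu0.exists_gradient
  have hui : ∀ i, MemLp (fun x => u x i) 2 (volume.restrict Ω) := fun i =>
    (EuclideanSpace.proj (𝕜 := ℝ) i : E3 →L[ℝ] ℝ).comp_memLp' hDu.1
  have flux := hg.integral_horizontal_flux hh hH hSΩ hσ0 hσ hΩ haH hbH hui
    (fun φ hφ hφc => integral_sum_mul_fderiv_eq_zero hΩ hDu hD hdiv hφ hφc) huS huP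
  have ce : ∀ l : Fin 2, ContDiff ℝ 1 fun y : E2 => slope σ y * y l := fun l =>
    (contDiff_slope σ).mul (contDiff_euclidean.1 contDiff_id l)
  have second := fun (j : Fin 3) (l : Fin 2) => hg.integral_eq_second_derivative hh hH hSo hSΩ hσ hΩ
    haH hbH (hui j) (hDu.2 2 j).2 (hDu.2 2 j).1 (fun φ hφ hφc => hD φ hφ hφc 2 j)
    (contDiff_rigidVelocity v w c j) (huS.mono fun x hx => by rw [hx]) (hDu'.2 2 j).1
    (hD2' 2 2 j).1 (hD2' 2 2 j).2 (ce l) fun y hy => by rw [slope_eq_zero hσ0 hy, zero_mul]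
  rw [second 0 0, second 1 1] at flux
  have cs : Continuous (slope σ) := (contDiff_slope σ).continuous
  have cp : Continuous (profile σ) := (contDiff_profile σ).continuous
  have ca : Continuous a := hg.contDiff_bottom.continuous
  have cb : Continuous b := hg.contDiff_top.continuous
  have ball_int : ∀ {q : E2 → ℝ}, Continuous q → IntegrableOn q (Metric.ball 0 σ) := fun hq =>
    (hq.continuousOn.integrableOn_compact (isCompact_closedBall (0 : E2) σ)).mono_set
      Metric.ball_subset_closedBall
  have e0 : ∀ y, rigidVelocity v w c (pt y (h + b y)) 0 = uP 0 + (w 1 * b y - w 2 * y 1) := fun y => by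
    rw [(rigidVelocity_components v w c _ h).1, ← huP]
    simp
  have e1 : ∀ y, rigidVelocity v w c (pt y (h + b y)) 1 = uP 1 + (w 2 * y 0 - w 0 * b y) := fun y => by
    rw [(rigidVelocity_components v w c _ h).2.1, ← huP]
    simp
  simp_rw [e0, e1] at flux
  let T : E2 → ℝ := fun y => slope σ y * (uP 0 * y 0 + uP 1 * y 1)
  have hT : Continuous T := by simp only [T]; fun_prop
  have hTneg : ∀ y, T (-y) = -T y := fun y => by
    simp only [T, slope_neg, PiLp.neg_apply]; ring
  have hodd : ∫ y in Metric.ball (0 : E2) σ, T y * h = 0 :=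
    setIntegral_ball_eq_zero_of_odd fun y => by rw [hTneg]; ring
  -- Since T is odd, reflection replaces a + b by half of its difference with the reflected values;
  -- this turns the factor 1/2 into 1/4.
  have hrefl : ∫ y in Metric.ball (0 : E2) σ, T y * (a y + b y) =
      -∫ y in Metric.ball (0 : E2) σ, T y * (a (-y) + b (-y)) := by
    rw [← setIntegral_ball_neg, ← integral_neg]
    simp_rw [hTneg, neg_mul]
  have hsplit : ∫ y in Metric.ball (0 : E2) σ, T y * ((a y - a (-y)) + (b y - b (-y))) =
      (∫ y in Metric.ball (0 : E2) σ, T y * (a y + b y)) -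
      ∫ y in Metric.ball (0 : E2) σ, T y * (a (-y) + b (-y)) := by
    rw [← integral_sub (ball_int (by fun_prop)) (ball_int (by fun_prop))]
    congr 1 with y
    ring
  -- Twice the trapezoidal boundary terms minus twice the flux. The translation leaves h + b - a -
  -- 2b = h - a - b, the rotation leaves b(h + b - a) - b² = b(h - a), and the w₃ terms cancel.
  have hsum : (∫ y in Metric.ball (0 : E2) σ, (uP 0 + (w 1 * b y - w 2 * y 1)) *
        (slope σ y * y 0 * (h + b y - a y))) +
      (∫ y in Metric.ball (0 : E2) σ, (uP 1 + (w 2 * y 0 - w 0 * b y)) *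
        (slope σ y * y 1 * (h + b y - a y))) -
      2 * (∫ y in Metric.ball (0 : E2) σ, (uP 2 * profile σ y +
        slope σ y * (uP 0 * y 0 + uP 1 * y 1) * b y +
        slope σ y * (w 1 * y 0 - w 0 * y 1) * (b y ^ 2 / 2))) =
      (∫ y in Metric.ball (0 : E2) σ, T y * h) -
      (∫ y in Metric.ball (0 : E2) σ, T y * (a y + b y)) +
      (∫ y in Metric.ball (0 : E2) σ, slope σ y * (w 1 * y 0 + -w 0 * y 1) * (b y * (h - a y))) -
      2 * ∫ y in Metric.ball (0 : E2) σ, uP 2 * profile σ y := by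
    rw [← integral_const_mul, ← integral_const_mul,
      ← integral_add (ball_int (by fun_prop)) (ball_int (by fun_prop)),
      ← integral_sub (ball_int (by fun_prop)) (ball_int (by fun_prop)),
      ← integral_sub (ball_int (by fun_prop)) (ball_int (by fun_prop)),
      ← integral_add (ball_int (by fun_prop)) (ball_int (by fun_prop)),
      ← integral_sub (ball_int (by fun_prop)) (ball_int (by fun_prop))]
    congr 1 with y
    simp only [T]
    ring
  rw [hodd, integral_const_mul] at hsum
  change _ = _ - 1 / 4 * (∫ y in Metric.ball (0 : E2) σ, T y * ((a y - a (-y)) + (b y - b (-y)))) + _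
  rw [hsplit]
  linarith

/-- The contribution of the translation of the body to the flux. -/
theorem IsGap.abs_integral_translation_le (hg : IsGap k K h r H S Ω a b) (hK : 0 ≤ K)
    (hσ0 : 0 < σ) (hσ : σ ≤ r) (uP : E3) :
    |∫ y in Metric.ball (0 : E2) σ, slope σ y * (uP 0 * y 0 + uP 1 * y 1) *
        ((a y - a (-y)) + (b y - b (-y)))| ≤
      8 * Real.exp (-2) / σ * ‖horiz uP‖ * (4 * K * σ ^ 3) * (Real.pi * σ ^ 2) := by
  refine abs_setIntegral_ball_le hσ0.le fun y hy => ?_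
  have h1 := abs_slope_mul_le hσ0 (uP 0) (uP 1) y
  rw [← horiz_zero uP, ← horiz_one uP, ← norm_eq_sqrt] at h1
  have h2 := hg.bottom_odd_le y (hy.trans_le hσ)
  have h3 := hg.top_odd_le y (hy.trans_le hσ)
  have h4 : 2 * K * ‖y‖ ^ 3 ≤ 2 * K * σ ^ 3 := by gcongr
  rw [abs_mul]
  refine mul_le_mul h1 ?_ (abs_nonneg _) (by positivity)
  linarith [abs_add_le (a y - a (-y)) (b y - b (-y))]

/-- The contribution of the rotation of the body to the flux. -/
theorem IsGap.abs_integral_rotation_le (hg : IsGap k K h r H S Ω a b) (hk : 0 ≤ k) (hkK : k ≤ K)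
    (hh : 0 ≤ h) (hσ0 : 0 < σ) (hσ : σ ≤ r) (w : E3) :
    |∫ y in Metric.ball (0 : E2) σ, slope σ y * (w 1 * y 0 + -w 0 * y 1) * (b y * (h - a y))| ≤
      8 * Real.exp (-2) / σ * ‖horiz w‖ * (K * σ ^ 2 * (h + 2 * K * σ ^ 2)) *
        (Real.pi * σ ^ 2) := by
  have hK : 0 ≤ K := hk.trans hkK
  refine abs_setIntegral_ball_le hσ0.le fun y hy => ?_
  have h1 := abs_slope_mul_le hσ0 (w 1) (-w 0) y
  rw [neg_sq, add_comm (w 1 ^ 2), ← horiz_zero w, ← horiz_one w, ← norm_eq_sqrt] at h1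
  obtain ⟨h2, h3⟩ := hg.abs_le_of_lt hk hσ hy
  have h4 : k * σ ^ 2 ≤ K * σ ^ 2 := by gcongr
  have h5 : 0 ≤ K * σ ^ 2 := by positivity
  rw [abs_mul, abs_mul (b y)]
  refine mul_le_mul h1 ?_ (by positivity) (by positivity)
  refine mul_le_mul (h3.trans h4) ?_ (abs_nonneg _) h5
  rw [abs_le]
  constructor <;> linarith [(abs_le.1 h2).1, (abs_le.1 h2).2]

end RigidFluid

/-! ### Conclusion -/

theorem proposition3p1 (K : ℝ) (hK : 1 ≤ K) :
    ∃ C : ℝ, 0 < C ∧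
      ∀ (k σ₀ : ℝ) (Ω S : Set E3) (h : ℝ) (u : E3 → E3) (v w c uP : E3)
        (D2u : E3 → Fin 3 → Fin 3 → Fin 3 → ℝ),
        -- the constants of the two domains
        0 < k → k ≤ K → 0 < σ₀ →
        -- the container and the body
        IsOpen Ω → IsConnected Ω →
        IsOpen S → IsConnected S → Bornology.IsBounded S → S ⊆ Ω →
        UniformlyC3 k K σ₀ Ω → UniformlyC3 k K σ₀ S →
        -- the distance `h` is realized by `Q = 0` and `P = (0, 0, h)`
        h = setDist S (frontier Ω) → h ≤ Metric.diam S →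
        (0 : E3) ∈ frontier Ω → (!₂[0, 0, h] : E3) ∈ frontier S →
        -- the third axis is the inner normal of the container at `Q`
        IsInnerNormal Ω 0 (basisVec 2) →
        -- the velocity field, with rigid velocity `uP` at `P`
        c ∈ closure S → MemW120Rigid S Ω u v w c → IsDivFree Ω u →
        HasW22Hessian (fluid S Ω) u D2u →
        uP = rigidVelocity v w c !₂[0, 0, h] →
        ∀ σ : ℝ, 0 < σ → σ ≤ σ₀ / 2 →
          |uP 2| ≤ 3 * Real.pi ^ (-(1 / 2) : ℝ) * σ ^ (-2 : ℤ) * (h + 2 * K * σ ^ 2) ^ (5 / 2 : ℝ)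
                * hessianL2 (cyl k h σ ∩ fluid S Ω) D2u
              + C * σ ^ 2 * ‖horiz uP‖
              + C * σ * (h + 2 * K * σ ^ 2) * ‖horiz w‖ := by
  -- The translational term gives exactly 16K after division by the lower bound for the integral of
  -- the profile; the rotational term needs only 8K.
  refine ⟨16 * K, by linarith, ?_⟩
  intro k σ₀ Ω S h u v w c uP D2u hk hkK hσ₀ hΩo _ hSo _ _ hSΩ hΩ hS hh _ h0 hP hn _ hu hdiv hD2
    huP σ hσ hσσ₀
  have hPt : (!₂[0, 0, h] : E3) = pt 0 h := by ext i; fin_cases i <;> rfl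
  rw [hPt] at hP huP
  have hh0 : 0 ≤ h := hh ▸ setDist_nonneg _ _
  have hK0 : 0 < K := by linarith
  obtain ⟨a, b, hg⟩ := exists_isGap hk hσ₀ hΩo hSΩ hΩ hS hh h0 hP hn
  have hσr : σ < 3 * σ₀ / 4 := by linarith
  -- From σ ≤ σ₀/2: both graphs stay within a quarter of the depth kσ₀², the region where the
  -- vertical cutoff equals one.
  have hsq : k * σ ^ 2 ≤ k * σ₀ ^ 2 / 4 := by
    have : σ ^ 2 ≤ (σ₀ / 2) ^ 2 := by gcongr
    nlinarith
  have identity := hg.normal_velocity_identity hh0 (by positivity) hSo hSΩ hσ hσr hΩo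
    (fun y hy => (hg.abs_le_of_lt hk.le hσr.le hy).1.trans hsq)
    (fun y hy => (hg.abs_le_of_lt hk.le hσr.le hy).2.trans hsq) hu hdiv hD2 huP
  have b1 := hg.abs_integral_second_derivative_le hk hkK hh0 hσ hσr.le (D2u := D2u) fun i j l => by
    obtain ⟨_, _, hD2'⟩ := hD2
    exact (hD2' i j l).2
  have b2 := hg.abs_integral_translation_le hK0.le hσ hσr.le uP
  have b3 := hg.abs_integral_rotation_le hk.le hkK hh0 hσ hσr.le w
  have b0 := le_integral_profile hσ
  set I := ∫ y in Metric.ball (0 : E2) σ, profile σ y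
  set D := h + 2 * K * σ ^ 2 with hD
  have hD0 : 0 < D := by positivity
  set N := hessianL2 (cyl k h σ ∩ fluid S Ω) D2u
  have hN : 0 ≤ N := Real.sqrt_nonneg _
  have hE : 0 < Real.exp (-2) := Real.exp_pos _
  set E := Real.exp (-2)
  set M := 8 * E / σ
  have hpi := Real.pi_pos
  have hI : 0 < E * Real.pi * σ ^ 2 / 2 := by positivity
  have main : |uP 2| * (E * Real.pi * σ ^ 2 / 2) ≤
      1 / 2 * (2 * E / σ * D ^ 2 * (N * √(D * (Real.pi * σ ^ 2)))) +
      1 / 4 * (M * ‖horiz uP‖ * (4 * K * σ ^ 3) * (Real.pi * σ ^ 2)) +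
      1 / 2 * (M * ‖horiz w‖ * (K * σ ^ 2 * D) * (Real.pi * σ ^ 2)) := by
    calc |uP 2| * (E * Real.pi * σ ^ 2 / 2) ≤ |uP 2| * I := by gcongr
      _ = |uP 2 * I| := by rw [abs_mul, abs_of_pos (hI.trans_le b0)]
      _ ≤ _ := by
        rw [identity, abs_le]
        rw [abs_le] at b1 b2 b3
        constructor <;> linarith [b1.1, b1.2, b2.1, b2.2, b3.1, b3.2]
  refine le_of_mul_le_mul_right (main.trans ?_) hI
  have hs1 : √(D * (Real.pi * σ ^ 2)) = √D * √Real.pi * σ := by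
    rw [Real.sqrt_mul hD0.le, Real.sqrt_mul hpi.le, Real.sqrt_sq hσ.le]; ring
  have hs2 : D ^ (5 / 2 : ℝ) = D ^ 2 * √D := by
    rw [show (5 / 2 : ℝ) = 2 + 1 / 2 by norm_num, Real.rpow_add hD0, Real.rpow_two,
      Real.sqrt_eq_rpow]
  have hs3 : Real.pi ^ (-(1 / 2) : ℝ) = (√Real.pi)⁻¹ := by
    rw [Real.rpow_neg hpi.le, Real.sqrt_eq_rpow]
  have hs4 : σ ^ (-2 : ℤ) = (σ ^ 2)⁻¹ := by
    rw [zpow_neg]; norm_cast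
  have hs5 : Real.pi = √Real.pi * √Real.pi := (Real.mul_self_sqrt hpi.le).symm
  have t1 : 1 / 2 * (2 * E / σ * D ^ 2 * (N * √(D * (Real.pi * σ ^ 2)))) ≤
      3 * Real.pi ^ (-(1 / 2) : ℝ) * σ ^ (-2 : ℤ) * D ^ (5 / 2 : ℝ) * N *
        (E * Real.pi * σ ^ 2 / 2) := by
    have e1 : 1 / 2 * (2 * E / σ * D ^ 2 * (N * √(D * (Real.pi * σ ^ 2)))) =
        E * D ^ 2 * N * √D * √Real.pi := by
      rw [hs1]; field_simp
    have e2 : 3 * Real.pi ^ (-(1 / 2) : ℝ) * σ ^ (-2 : ℤ) * D ^ (5 / 2 : ℝ) * N *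
        (E * Real.pi * σ ^ 2 / 2) = 3 / 2 * (E * D ^ 2 * N * √D * √Real.pi) := by
      have : 0 < √Real.pi := Real.sqrt_pos.2 hpi
      rw [hs2, hs3, hs4]
      nth_rewrite 2 [hs5]
      field_simp
    rw [e1, e2]
    have : 0 ≤ E * D ^ 2 * N * √D * √Real.pi := by positivity
    linarith
  have t2 : 1 / 4 * (M * ‖horiz uP‖ * (4 * K * σ ^ 3) * (Real.pi * σ ^ 2)) =
      16 * K * σ ^ 2 * ‖horiz uP‖ * (E * Real.pi * σ ^ 2 / 2) := by
    simp only [M]; field_simp; ring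
  have t3 : 1 / 2 * (M * ‖horiz w‖ * (K * σ ^ 2 * D) * (Real.pi * σ ^ 2)) ≤
      16 * K * σ * D * ‖horiz w‖ * (E * Real.pi * σ ^ 2 / 2) := by
    have e1 : 1 / 2 * (M * ‖horiz w‖ * (K * σ ^ 2 * D) * (Real.pi * σ ^ 2)) =
        8 * K * σ * D * ‖horiz w‖ * (E * Real.pi * σ ^ 2 / 2) := by
      simp only [M]; field_simp
    rw [e1]
    gcongr
    norm_num
  exact (add_le_add (add_le_add t1 t2.le) t3).trans_eq (by ring)
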